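/- Let $\alpha>0$. There is an integer $m=m(\alpha)\ge 0$ such that the following holds for every $g\in C^m([-1,1])$ (that is, for every sufficiently smooth $g$) and every $\xi\in[-1,1]$. Put $$f(x)=|x-\xi|^{\alpha}g(x),\qquad a_k=\frac{2}{\pi}\int_{-1}^{1}\frac{f(x)T_k(x)}{\sqrt{1-x^2}}\,dx,\qquad f_n(x)=\frac{a_0}{2}+\sum_{k=1}^{n}a_kT_k(x),$$ so that $f_n$ is the Chebyshev projection of $f$ of degree $n$; here $T_k$ and $U_k$ denote the Chebyshev polynomials of degree $k$ of the first and second kind. Put $\varphi^{\pm}=\varphi^{\pm}_\xi(x)=\tfrac12(\arccos x\pm\arccos\xi)$ and $$I_1=-\frac{4(1-\xi^2)^{\alpha/2}\,\Gamma(\alpha+1)}{\pi}\sin\!\Big(\frac{\alpha\pi}{2}\Big)g(\xi),\qquad B=-\frac{\sin(\alpha\pi)\,\Gamma(2\alpha+1)}{2^{\alpha-1}\pi}\,g(\xi).$$ All $O$-terms below are for $n\to\infty$ with $\alpha,\xi,g$ and $x$ fixed. (i) Suppose $\xi\in(-1,1)$ and $\alpha$ is not an even integer. Then for every $x\in[-1,1]$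 with $x\ne\xi$, $$f(x)-f_n(x)=-\frac{I_1}{4}\big[U_{2n}(\cos\varphi^{+})+U_{2n}(\cos\varphi^{-})\big]n^{-\alpha-1}+O(n^{-\alpha-2}),$$ and at $x=\xi$, $$f(\xi)-f_n(\xi)=\frac{I_1}{2\alpha}\,n^{-\alpha}-I_1\,\frac{U_{2n}(\xi)+1}{4}\,n^{-\alpha-1}+O(n^{-\alpha-2}).$$ (ii) Suppose $\xi\in\{-1,1\}$ and $\alpha$ is not an integer. Then at $x=\xi$, $$f(\xi)-f_n(\xi)=B\Big[\frac{1}{2\alpha}\,n^{-2\alpha}-\frac12\,n^{-2\alpha-1}\Big]+O(n^{-2\alpha-2}),$$ and for every $x\in[-1,1]$ with $x\ne\xi$, and for either choice of the sign $\pm$, $$f(x)-f_n(x)=-\frac{B}{2}\,U_{2n}(\cos\varphi^{\pm})\,n^{-2\alpha-1}+O(n^{-2\alpha-2}).$$ -/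

import Mathlib

open Filter Asymptotics

noncomputable section

namespace ChebProj

/-- The model function `f(x) = |x - ξ|^α g(x)`. -/
def modelFun (α ξ : ℝ) (g : ℝ → ℝ) (x : ℝ) : ℝ := |x - ξ| ^ α * g x

/-- Value of the Chebyshev polynomial of the first kind `T_k(x)`. -/
def chebT (k : ℕ) (x : ℝ) : ℝ := (Polynomial.Chebyshev.T ℝ (k : ℤ)).eval x

/-- Value of the Chebyshev polynomial of the second kind `U_k(x)`. -/
def chebU (k : ℕ) (x : ℝ) : ℝ := (Polynomial.Chebyshev.U ℝ (k : ℤ)).eval x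

/-- The Chebyshev coefficient `a_k = (2/π) ∫_{-1}^{1} f(x) T_k(x) / √(1 - x²) dx`. -/
def chebCoeff (f : ℝ → ℝ) (k : ℕ) : ℝ :=
  2 / Real.pi * ∫ x in (-1 : ℝ)..1, f x * chebT k x / Real.sqrt (1 - x ^ 2)

/-- The Chebyshev projection of degree `n`: the sum of `a_k T_k(x)` over `0 ≤ k ≤ n`, with the
term `k = 0` halved. -/
def chebProj (f : ℝ → ℝ) (n : ℕ) (x : ℝ) : ℝ :=
  chebCoeff f 0 / 2 * chebT 0 x + ∑ k ∈ Finset.Icc 1 n, chebCoeff f k * chebT k x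

/-- `φ_ξ^+(x) = (arccos x + arccos ξ) / 2`. -/
def phiPlus (ξ x : ℝ) : ℝ := (Real.arccos x + Real.arccos ξ) / 2

/-- `φ_ξ^-(x) = (arccos x - arccos ξ) / 2`. -/
def phiMinus (ξ x : ℝ) : ℝ := (Real.arccos x - Real.arccos ξ) / 2

/-- The constant `I₁(α, ξ)`; it depends on `g` through `g(ξ)`. -/
def constI (α ξ : ℝ) (g : ℝ → ℝ) : ℝ :=
  -(4 * (1 - ξ ^ 2) ^ (α / 2) * Real.Gamma (α + 1) / Real.pi)
    * Real.sin (α * Real.pi / 2) * g ξ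

/-- The constant `B(α, ξ)`; it depends on `g` through `g(ξ)`. -/
def constB (α ξ : ℝ) (g : ℝ → ℝ) : ℝ :=
  -(Real.sin (α * Real.pi) * Real.Gamma (2 * α + 1) / ((2 : ℝ) ^ (α - 1) * Real.pi)) * g ξ

end ChebProj

end

/-! With x = cos θ and ξ = cos τ, the Chebyshev series of f is the Fourier cosine series of f(cos
θ), and |cos θ - cos τ|^α = 2^(-α) |2 sin((θ-τ)/2)|^α |2 sin((θ+τ)/2)|^α. A smooth splitting of
unity writes f(cos θ) = P(θ) + P(-θ) with P(θ) = |2 sin((θ-τ)/2)|^β ψ(θ) and ψ smooth and periodic.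
In the interior β = α; at an endpoint the two factors coincide and β = 2α.

Coefficients. Those of |2 sin(u/2)|^β obey an exact first-order recurrence, so they are L k^(-s) +
O(k^(-s-2)) with s = β + 1; L comes from the Gamma limit and the reflection formula
(`sinPowCoeff_isBigO`). Multiplication by ψ is a convolution with rapidly decaying coefficients;
expanding (k - l)^(-s) in l/k, and using that ψ is real, gives a_k = A cos(kτ) k^(-s) + σ sin(kτ)
k^(-s-1) + O(k^(-s-2)) (`exists_fourierCo_expansion`).

Tails. Multiplying by cos(kθ) produces the frequencies θ ± τ. For a frequency outside 2πℤ, summation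
by parts gives a cosine tail of order n^(-s), whose Dirichlet-type factor is U_{2n}. For a frequency
in 2πℤ, Euler–Maclaurin gives the larger n^(1-s)/(s-1) - n^(-s)/2. Sine terms never resonate, since
they vanish at frequencies in 2πℤ; hence σ does not enter the result. The cases of the theorem
record which of θ ± τ resonate. -/

noncomputable section

namespace ChebProj

open Real Topology MeasureTheory

/-! ### The model singularity: recurrence and mean value -/

/-- The periodic model singularity `|2 sin (u / 2)| ^ β`. -/
def sinPow (β u : ℝ) : ℝ := |2 * sin (u / 2)| ^ β

/-- The Fourier coefficients of `sinPow β`. -/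
def sinPowCoeff (β : ℝ) (j : ℤ) : ℝ :=
  1 / (2 * π) * ∫ u in -π..π, sinPow β u * cos (j * u)

theorem continuous_sinPow {β : ℝ} (hβ : 0 < β) : Continuous (sinPow β) := by
  unfold sinPow
  exact Continuous.rpow_const (by fun_prop) fun _ => Or.inr hβ.le

theorem sinPow_neg (β u : ℝ) : sinPow β (-u) = sinPow β u := by
  simp [sinPow, neg_div]

theorem sinPow_periodic (β : ℝ) : Function.Periodic (sinPow β) (2 * π) := by
  intro u
  have : (u + 2 * π) / 2 = u / 2 + π := by ring
  simp [sinPow, this, sin_add_pi]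

/-- The extra factor t makes the function differentiable at 0 as well, so the integration by parts
below may run across the singularity. -/
theorem hasDerivAt_abs_rpow_mul_self {β : ℝ} (hβ : 0 < β) (t : ℝ) :
    HasDerivAt (fun t : ℝ => |t| ^ β * t) ((β + 1) * |t| ^ β) t := by
  rcases eq_or_ne t 0 with rfl | ht
  · rw [hasDerivAt_iff_tendsto_slope]
    simp only [abs_zero, zero_rpow hβ.ne', mul_zero]
    have h : Tendsto (fun t : ℝ => |t| ^ β) (𝓝[≠] 0) (𝓝 0) := by
      have : Continuous fun t : ℝ => |t| ^ β :=
        Continuous.rpow_const (by fun_prop) fun _ => Or.inr hβ.le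
      have h := this.tendsto 0
      simp only [abs_zero, zero_rpow hβ.ne'] at h
      exact h.mono_left nhdsWithin_le_nhds
    refine h.congr' ?_
    filter_upwards [self_mem_nhdsWithin] with u hu
    have hu : u ≠ 0 := hu
    simp [slope_def_field, hu]
  · have h := ((hasDerivAt_abs ht).rpow_const (p := β) (Or.inl (abs_ne_zero.2 ht))).mul
      (hasDerivAt_id t)
    refine h.congr_deriv ?_
    have h1 : |t| ^ (β - 1) = |t| ^ β / |t| := rpow_sub_one (abs_ne_zero.2 ht) β
    have h2 : ((SignType.sign t : SignType) : ℝ) * t = |t| := by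
      rw [mul_comm]; exact self_mul_sign t
    have h3 : |t| ≠ 0 := abs_ne_zero.2 ht
    rw [h1]
    simp only [id]
    field_simp
    linear_combination (β : ℝ) * h2

/-- With w = 2 sin(u/2), the function |w|^β w cos((k+1/2)u) vanishes at ±π, and by the addition
formulas its derivative combines exactly the two integrands of orders k and k + 1. -/
theorem sinPowCoeff_succ {β : ℝ} (hβ : 0 < β) (k : ℕ) :
    (k + 1 + β / 2) * sinPowCoeff β (k + 1) = (k - β / 2) * sinPowCoeff β k := by
  have hd : ∀ u ∈ Set.uIcc (-π) π, HasDerivAt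
      (fun u : ℝ => |2 * sin (u / 2)| ^ β * (2 * sin (u / 2)) * cos ((k + 1 / 2) * u))
      ((k + 1 + β / 2) * (sinPow β u * cos ((k + 1 : ℝ) * u))
        - (k - β / 2) * (sinPow β u * cos (k * u))) u := by
    intro u _
    have h1 : HasDerivAt (fun u : ℝ => 2 * sin (u / 2)) (cos (u / 2)) u := by
      have := (((hasDerivAt_id u).div_const 2).sin).const_mul 2
      exact this.congr_deriv (by simp; ring)
    have h2 := (hasDerivAt_abs_rpow_mul_self hβ (2 * sin (u / 2))).comp u h1
    have h3 : HasDerivAt (fun u : ℝ => cos ((k + 1 / 2) * u))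
        (-sin ((k + 1 / 2) * u) * (k + 1 / 2)) u := by
      have := ((hasDerivAt_id u).const_mul ((k : ℝ) + 1 / 2)).cos
      simpa using this
    have h4 := h2.mul h3
    refine h4.congr_deriv ?_
    have e1 : ((k : ℝ) + 1) * u = (k + 1 / 2) * u + u / 2 := by ring
    have e2 : (k : ℝ) * u = (k + 1 / 2) * u - u / 2 := by ring
    rw [e1, e2, cos_add, cos_sub]
    simp only [sinPow, Function.comp]
    ring
  have hi1 : IntervalIntegrable (fun u => sinPow β u * cos ((k + 1 : ℝ) * u)) volume (-π) π :=
    ((continuous_sinPow hβ).mul (by fun_prop)).intervalIntegrable _ _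
  have hi2 : IntervalIntegrable (fun u => sinPow β u * cos ((k : ℝ) * u)) volume (-π) π :=
    ((continuous_sinPow hβ).mul (by fun_prop)).intervalIntegrable _ _
  have h := intervalIntegral.integral_eq_sub_of_hasDerivAt hd
    ((hi1.const_mul _).sub (hi2.const_mul _))
  rw [intervalIntegral.integral_sub (hi1.const_mul _) (hi2.const_mul _),
    intervalIntegral.integral_const_mul, intervalIntegral.integral_const_mul] at h
  have hc : cos ((k + 1 / 2) * π) = 0 := by
    rw [cos_eq_zero_iff]; exact ⟨k, by push_cast; ring⟩
  have hc' : cos ((k + 1 / 2) * -π) = 0 := by rw [mul_neg, cos_neg, hc]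
  rw [hc, hc', mul_zero, mul_zero, sub_zero] at h
  simp only [sinPowCoeff, Int.cast_natCast, Int.cast_add, Int.cast_one]
  linear_combination (1 / (2 * π)) * h

/-- The substitution y = sin²(u/2) turns this into the Beta integral B((β+1)/2, 1/2). -/
theorem integral_sin_half_rpow {β : ℝ} (hβ : 0 < β) :
    ∫ u in (0 : ℝ)..π, sin (u / 2) ^ β =
      Gamma ((β + 1) / 2) * Gamma (1 / 2) / Gamma (β / 2 + 1) := by
  have himg : (fun u : ℝ => sin (u / 2) ^ 2) '' Set.Ioo 0 π = Set.Ioo 0 1 := by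
    ext y
    constructor
    · rintro ⟨u, ⟨h0, h1⟩, rfl⟩
      have hs : 0 < sin (u / 2) := sin_pos_of_pos_of_lt_pi (by linarith) (by linarith)
      have hc : 0 < cos (u / 2) := cos_pos_of_mem_Ioo ⟨by linarith, by linarith⟩
      have := sin_sq_add_cos_sq (u / 2)
      exact ⟨by positivity, by simp only; nlinarith⟩
    · rintro ⟨h0, h1⟩
      have hs0 : 0 < √y := sqrt_pos.2 h0
      have hs1 : √y < 1 := by rw [sqrt_lt' one_pos]; simpa using h1
      refine ⟨2 * arcsin (√y), ⟨?_, ?_⟩, ?_⟩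
      · have := arcsin_pos.2 hs0; linarith
      · have := arcsin_lt_pi_div_two.2 hs1; linarith
      · simp only [mul_div_cancel_left₀ _ (two_ne_zero' ℝ)]
        rw [sin_arcsin (by linarith) hs1.le, sq_sqrt h0.le]
  have hder : ∀ u ∈ Set.Ioo 0 π, HasDerivWithinAt (fun u : ℝ => sin (u / 2) ^ 2)
      (sin (u / 2) * cos (u / 2)) (Set.Ioo 0 π) u := by
    intro u _
    have := ((((hasDerivAt_id u).div_const 2).sin).pow 2).hasDerivWithinAt (s := Set.Ioo 0 π)
    exact this.congr_deriv (by simp; ring)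
  have hinj : Set.InjOn (fun u : ℝ => sin (u / 2) ^ 2) (Set.Ioo 0 π) := by
    intro u hu v hv h
    have hu' : 0 < sin (u / 2) :=
      sin_pos_of_pos_of_lt_pi (by linarith [hu.1]) (by linarith [hu.2, pi_pos])
    have hv' : 0 < sin (v / 2) :=
      sin_pos_of_pos_of_lt_pi (by linarith [hv.1]) (by linarith [hv.2, pi_pos])
    have h' := (sq_eq_sq₀ hu'.le hv'.le).1 h
    have := injOn_sin ⟨by linarith [hu.1, pi_pos], by linarith [hu.2]⟩
      ⟨by linarith [hv.1, pi_pos], by linarith [hv.2]⟩ h'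
    linarith
  have key := integral_image_eq_integral_abs_deriv_smul measurableSet_Ioo hder hinj
    (fun x : ℝ => (x : ℂ) ^ ((((β + 1) / 2 : ℝ) : ℂ) - 1) *
      (1 - (x : ℂ)) ^ (((1 / 2 : ℝ) : ℂ) - 1))
  rw [himg] at key
  have hB : Complex.betaIntegral (((β + 1) / 2 : ℝ) : ℂ) ((1 / 2 : ℝ) : ℂ)
      = ((∫ u in (0 : ℝ)..π, sin (u / 2) ^ β : ℝ) : ℂ) := by
    rw [Complex.betaIntegral, intervalIntegral.integral_of_le zero_le_one,
      integral_Ioc_eq_integral_Ioo, key, ← intervalIntegral.integral_ofReal,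
      intervalIntegral.integral_of_le pi_pos.le, integral_Ioc_eq_integral_Ioo]
    refine setIntegral_congr_fun measurableSet_Ioo ?_
    intro u hu
    have hs : 0 < sin (u / 2) :=
      sin_pos_of_pos_of_lt_pi (by linarith [hu.1]) (by linarith [hu.2, pi_pos])
    have hc : 0 < cos (u / 2) := cos_pos_of_mem_Ioo ⟨by linarith [hu.1, pi_pos], by linarith [hu.2]⟩
    have e1 : (1 : ℝ) - sin (u / 2) ^ 2 = cos (u / 2) ^ 2 := by
      linarith [sin_sq_add_cos_sq (u / 2)]
    have e2 : (sin (u / 2) ^ 2) ^ ((β + 1) / 2 - 1) * sin (u / 2) = sin (u / 2) ^ β := by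
      rw [← rpow_natCast, ← rpow_mul hs.le, ← rpow_add_one hs.ne']
      congr 1; push_cast; ring
    have e3 : (cos (u / 2) ^ 2) ^ ((1 : ℝ) / 2 - 1) * cos (u / 2) = 1 := by
      rw [← rpow_natCast, ← rpow_mul hc.le, ← rpow_add_one hc.ne']
      norm_num
    have c1 : (((sin (u / 2) ^ 2 : ℝ)) : ℂ) ^ ((((β + 1) / 2 : ℝ) : ℂ) - 1)
        = (((sin (u / 2) ^ 2) ^ ((β + 1) / 2 - 1) : ℝ) : ℂ) := by
      rw [Complex.ofReal_cpow (by positivity)]; push_cast; rfl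
    have c2 : (1 - ((sin (u / 2) ^ 2 : ℝ) : ℂ)) ^ ((((1 / 2 : ℝ)) : ℂ) - 1)
        = (((cos (u / 2) ^ 2) ^ ((1 : ℝ) / 2 - 1) : ℝ) : ℂ) := by
      rw [← e1, Complex.ofReal_cpow (by rw [e1]; positivity)]; push_cast; rfl
    simp only
    rw [c1, c2, abs_of_pos (mul_pos hs hc), ← e2, Complex.real_smul]
    norm_cast
    linear_combination (sin (u / 2) * (sin (u / 2) ^ 2) ^ ((β + 1) / 2 - 1)) * e3
  have hG := Complex.Gamma_mul_Gamma_eq_betaIntegral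
    (s := (((β + 1) / 2 : ℝ) : ℂ)) (t := ((1 / 2 : ℝ) : ℂ)) (by simp; linarith) (by simp)
  rw [hB, ← Complex.ofReal_add, Complex.Gamma_ofReal, Complex.Gamma_ofReal,
    Complex.Gamma_ofReal] at hG
  norm_cast at hG
  rw [show (β + 1) / 2 + 1 / 2 = β / 2 + 1 by ring] at hG
  rw [eq_div_iff (Gamma_pos_of_pos (by linarith)).ne', hG]
  ring

/-- Legendre's duplication formula at (β+1)/2 rewrites the Beta value. -/
theorem sinPowCoeff_zero {β : ℝ} (hβ : 0 < β) :
    sinPowCoeff β 0 = Gamma (β + 1) / Gamma (β / 2 + 1) ^ 2 := by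
  have h1 : ∫ u in -π..π, sinPow β u = 2 * ∫ u in (0 : ℝ)..π, sinPow β u := by
    have hi : ∀ a b, IntervalIntegrable (sinPow β) volume a b :=
      fun a b => (continuous_sinPow hβ).intervalIntegrable _ _
    rw [← intervalIntegral.integral_add_adjacent_intervals (hi (-π) 0) (hi 0 π), two_mul]
    congr 1
    have := intervalIntegral.integral_comp_neg (a := 0) (b := π) (sinPow β)
    simp only [sinPow_neg, neg_zero] at this
    exact this.symm
  have h2 : ∫ u in (0 : ℝ)..π, sinPow β u = 2 ^ β * ∫ u in (0 : ℝ)..π, sin (u / 2) ^ β := by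
    rw [← intervalIntegral.integral_const_mul]
    refine intervalIntegral.integral_congr fun u hu => ?_
    rw [Set.uIcc_of_le pi_pos.le] at hu
    have hs : 0 ≤ sin (u / 2) := sin_nonneg_of_nonneg_of_le_pi (by linarith [hu.1])
      (by linarith [hu.2, pi_pos])
    simp only [sinPow]
    rw [abs_of_nonneg (by positivity), mul_rpow zero_le_two hs]
  have h3 := Gamma_mul_Gamma_add_half ((β + 1) / 2)
  rw [show (β + 1) / 2 + 1 / 2 = β / 2 + 1 by ring, show 2 * ((β + 1) / 2) = β + 1 by ring,
    show 1 - (β + 1) = -β by ring, rpow_neg zero_le_two] at h3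
  have hg : Gamma (β / 2 + 1) ≠ 0 := (Gamma_pos_of_pos (by linarith)).ne'
  have h4 : (2 : ℝ) ^ β ≠ 0 := by positivity
  have hpi := sq_sqrt pi_pos.le
  simp only [sinPowCoeff, Int.cast_zero, zero_mul, cos_zero, mul_one]
  rw [h1, h2, integral_sin_half_rpow hβ, Gamma_one_half_eq]
  field_simp at h3 ⊢
  linear_combination √π * h3 + Gamma (β + 1) * hpi

/-! ### Decay from increments, and Taylor remainders -/

/-- The inequality n^(-q) - (n+1)^(-q) ≥ q (n+1)^(-q-1) comes from log y ≤ y - 1 and e^t ≥ 1 + t;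
then n + 1 ≤ 2n costs the factor 2^(q+1). The right-hand side telescopes. -/
theorem rpow_neg_sub_one_le_mul_sub {q : ℝ} (hq : 0 < q) {n : ℕ} (hn : 1 ≤ n) :
    (n : ℝ) ^ (-q - 1) ≤ 2 ^ (q + 1) / q * ((n : ℝ) ^ (-q) - ((n + 1 : ℕ) : ℝ) ^ (-q)) := by
  have hn0 : (1 : ℝ) ≤ n := by exact_mod_cast hn
  have hm : (0 : ℝ) < n + 1 := by positivity
  have h1 : (1 + q / (n + 1)) * ((n : ℝ) + 1) ^ (-q) ≤ (n : ℝ) ^ (-q) := by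
    have hx : (n : ℝ) = (n + 1) * (1 - 1 / (n + 1)) := by field_simp; ring
    have hy : (0 : ℝ) < 1 - 1 / (n + 1) := by
      rw [sub_pos, div_lt_one hm]; linarith
    have h2 : 1 + q / (n + 1) ≤ (1 - 1 / (n + 1 : ℝ)) ^ (-q) := by
      rw [rpow_def_of_pos hy]
      have h3 := log_le_sub_one_of_pos hy
      have h4 := add_one_le_exp (log (1 - 1 / (n + 1 : ℝ)) * -q)
      have h5 : q * log (1 - 1 / (n + 1 : ℝ)) ≤ q * (1 - 1 / (n + 1 : ℝ) - 1) :=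
        mul_le_mul_of_nonneg_left h3 hq.le
      have h6 : q * (1 - 1 / (n + 1 : ℝ) - 1) = - (q / (n + 1)) := by ring
      linarith
    calc _ ≤ (1 - 1 / (n + 1 : ℝ)) ^ (-q) * ((n : ℝ) + 1) ^ (-q) := by gcongr
      _ = (n : ℝ) ^ (-q) := by
        rw [mul_comm, ← mul_rpow hm.le hy.le, ← hx]
  have h2 : ((n : ℝ)) ^ (-q - 1) ≤ 2 ^ (q + 1) * ((n : ℝ) + 1) ^ (-q - 1) := by
    have : ((2 : ℝ) * n) ^ (-q - 1) ≤ ((n : ℝ) + 1) ^ (-q - 1) :=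
      rpow_le_rpow_of_nonpos hm (by linarith) (by linarith)
    rw [mul_rpow zero_le_two (by linarith), show -q - 1 = -(q + 1) by ring,
      rpow_neg zero_le_two] at this
    rw [show -q - 1 = -(q + 1) by ring]
    have h2 : (0 : ℝ) < 2 ^ (q + 1) := by positivity
    rw [inv_mul_le_iff₀ h2] at this
    exact this
  refine h2.trans ?_
  rw [div_mul_eq_mul_div, le_div_iff₀ hq, mul_assoc]
  refine mul_le_mul_of_nonneg_left ?_ (by positivity)
  push_cast
  rw [rpow_sub_one hm.ne']
  have : q / (n + 1) * ((n : ℝ) + 1) ^ (-q) = ((n : ℝ) + 1) ^ (-q) / (n + 1) * q := by ring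
  linarith

/-- A null sequence with increments `O(n ^ (-q - 1))` is `O(n ^ (-q))`. -/
theorem isBigO_of_tendsto_zero_of_sub {E : Type*} [NormedAddCommGroup E] {q : ℝ} (hq : 0 < q)
    {Q : ℕ → E} (h0 : Tendsto Q atTop (𝓝 0))
    (hQ : (fun n : ℕ => Q n - Q (n + 1)) =O[atTop] fun n : ℕ => (n : ℝ) ^ (-q - 1)) :
    Q =O[atTop] fun n : ℕ => (n : ℝ) ^ (-q) := by
  obtain ⟨C, hC0, hC⟩ := hQ.exists_pos
  obtain ⟨N, hN⟩ := eventually_atTop.1 hC.bound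
  set K := C * (2 ^ (q + 1) / q) with hK
  have hK0 : 0 ≤ K := by positivity
  have hstep : ∀ n : ℕ, N + 1 ≤ n → ‖Q n - Q (n + 1)‖ ≤
      K * ((n : ℝ) ^ (-q) - ((n + 1 : ℕ) : ℝ) ^ (-q)) := by
    intro n hn
    refine (hN n (by omega)).trans ?_
    rw [norm_of_nonneg (by positivity), hK, mul_assoc]
    exact mul_le_mul_of_nonneg_left (rpow_neg_sub_one_le_mul_sub hq (by omega)) hC0.le
  have hsum : ∀ n : ℕ, N + 1 ≤ n → ∀ m : ℕ, ‖Q n - Q (n + m)‖ ≤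
      K * ((n : ℝ) ^ (-q) - ((n + m : ℕ) : ℝ) ^ (-q)) := by
    intro n hn m
    induction m with
    | zero => simp
    | succ m ih =>
      have h := hstep (n + m) (by omega)
      calc ‖Q n - Q (n + (m + 1))‖ = ‖(Q n - Q (n + m)) + (Q (n + m) - Q (n + m + 1))‖ := by
            congr 1; rw [← add_assoc]; abel
        _ ≤ _ := norm_add_le _ _
        _ ≤ _ := add_le_add ih h
        _ = _ := by rw [← add_assoc n m 1]; ring
  refine IsBigO.of_bound K ?_
  filter_upwards [eventually_ge_atTop (N + 1)] with n hn
  rw [norm_of_nonneg (by positivity)]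
  -- The telescoped bound is uniform in m, so m → ∞ replaces `Q (n + m)` by 0.
  have hlim : Tendsto (fun m : ℕ => ‖Q n - Q (n + m)‖) atTop (𝓝 ‖Q n - 0‖) := by
    refine (tendsto_const_nhds.sub ?_).norm
    have := (tendsto_add_atTop_iff_nat n).2 h0
    simpa only [add_comm] using this
  rw [sub_zero] at hlim
  refine le_of_tendsto hlim (Eventually.of_forall fun m => (hsum n hn m).trans ?_)
  refine mul_le_mul_of_nonneg_left ?_ hK0
  have : (0 : ℝ) ≤ ((n + m : ℕ) : ℝ) ^ (-q) := by positivity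
  linarith

/-- The mean value inequality gains one power of |x|; iterating it yields all the Taylor bounds
below. -/
theorem abs_le_of_abs_deriv_le_abs_pow {h h' : ℝ → ℝ} {C : ℝ} {n : ℕ} {S : Set ℝ}
    (hS : S.OrdConnected) (h0S : (0 : ℝ) ∈ S) (hC : 0 ≤ C) (h0 : h 0 = 0)
    (hd : ∀ x ∈ S, HasDerivAt h (h' x) x) (hb : ∀ x ∈ S, |h' x| ≤ C * |x| ^ n) :
    ∀ x ∈ S, |h x| ≤ C * |x| ^ (n + 1) := by
  intro x hx
  have hsub : Set.uIcc 0 x ⊆ S := hS.uIcc_subset h0S hx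
  have := (convex_uIcc (0 : ℝ) x).norm_image_sub_le_of_norm_hasDerivWithin_le
    (f := h) (f' := h') (C := C * |x| ^ n)
    (fun y hy => (hd y (hsub hy)).hasDerivWithinAt)
    (fun y hy => (hb y (hsub hy)).trans
      (mul_le_mul_of_nonneg_left (pow_le_pow_left₀ (abs_nonneg y)
        (by simpa using Set.abs_sub_left_of_mem_uIcc hy) n) hC))
    Set.left_mem_uIcc Set.right_mem_uIcc
  rw [h0, sub_zero, sub_zero, norm_eq_abs, norm_eq_abs] at this
  rw [pow_succ, ← mul_assoc]
  exact this

theorem abs_le_of_abs_deriv_le_pow {h h' : ℝ → ℝ} {C : ℝ} {n : ℕ} (hC : 0 ≤ C) (h0 : h 0 = 0)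
    (hd : ∀ x ∈ Set.Icc (0 : ℝ) 1, HasDerivAt h (h' x) x)
    (hb : ∀ x ∈ Set.Icc (0 : ℝ) 1, |h' x| ≤ C * x ^ n) :
    ∀ x ∈ Set.Icc (0 : ℝ) 1, |h x| ≤ C * x ^ (n + 1) := by
  intro x hx
  have := abs_le_of_abs_deriv_le_abs_pow Set.ordConnected_Icc (Set.left_mem_Icc.2 zero_le_one) hC
    h0 hd (fun y hy => by rw [abs_of_nonneg hy.1]; exact hb y hy) x hx
  rwa [abs_of_nonneg hx.1] at this

theorem hasDerivAt_one_add_rpow (p : ℝ) {x : ℝ} (hx : 0 ≤ x) :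
    HasDerivAt (fun x : ℝ => (1 + x) ^ p) (p * (1 + x) ^ (p - 1)) x := by
  have h := ((hasDerivAt_id x).const_add 1).rpow_const (p := p) (Or.inl (by simp; linarith))
  exact h.congr_deriv (by simp)

theorem exists_abs_one_add_rpow_le (p : ℝ) :
    ∃ C : ℝ, 0 ≤ C ∧ ∀ x ∈ Set.Icc (0 : ℝ) 1, |(1 + x) ^ p| ≤ C := by
  refine ⟨max 1 (2 ^ p), by positivity, fun x hx => ?_⟩
  rw [abs_of_nonneg (rpow_nonneg (by linarith [hx.1]) p)]
  rcases le_total 0 p with hp | hp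
  · exact le_max_of_le_right (rpow_le_rpow (by linarith [hx.1]) (by linarith [hx.2]) hp)
  · exact le_max_of_le_left (rpow_le_one_of_one_le_of_nonpos (by linarith [hx.1]) hp)

/-- The x² terms cancel: the second derivative of the difference is a multiple of x (1+x)^(2b-1).
With x = 1/n and b = β/2 this controls the ratio of consecutive normalised coefficients, and the
cancellation is why no k^(-β-2) term appears. -/
theorem exists_abs_sinPow_ratio_le (b : ℝ) : ∃ C : ℝ, 0 ≤ C ∧ ∀ x ∈ Set.Icc (0 : ℝ) 1,
    |(1 - b * x) * (1 + x) ^ (2 * b + 1) - (1 + (1 + b) * x)| ≤ C * x ^ 3 := by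
  obtain ⟨C, hC, hCb⟩ := exists_abs_one_add_rpow_le (2 * b + 1 - 1 - 1)
  refine ⟨|(2 * b + 1) * (2 * b * (1 + b))| * C, by positivity, ?_⟩
  refine abs_le_of_abs_deriv_le_pow (h' := fun x => -b * (1 + x) ^ (2 * b + 1)
    + (1 - b * x) * ((2 * b + 1) * (1 + x) ^ (2 * b + 1 - 1)) - (1 + b)) (by positivity) (by simp)
    ?_ ?_
  · intro x hx
    have h1 := (((hasDerivAt_id x).const_mul b).const_sub 1).mul
      (hasDerivAt_one_add_rpow (2 * b + 1) hx.1)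
    have h2 := h1.sub (((hasDerivAt_id x).const_mul (1 + b)).const_add 1)
    exact h2.congr_deriv (by simp)
  · refine abs_le_of_abs_deriv_le_pow (n := 1) (h' := fun x =>
      -b * ((2 * b + 1) * (1 + x) ^ (2 * b + 1 - 1))
      + (-b * ((2 * b + 1) * (1 + x) ^ (2 * b + 1 - 1)) +
       (1 - b * x) * ((2 * b + 1) * ((2 * b + 1 - 1) * (1 + x) ^ (2 * b + 1 - 1 - 1)))))
       (by positivity) (by simp; ring) ?_ ?_
    · intro x hx
      have h1 := (((hasDerivAt_id x).const_mul b).const_sub 1).mul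
        ((hasDerivAt_one_add_rpow (2 * b + 1 - 1) hx.1).const_mul (2 * b + 1))
      have h2 := (((hasDerivAt_one_add_rpow (2 * b + 1) hx.1).const_mul (-b)).add h1).sub_const
        (1 + b)
      exact h2.congr_deriv (by simp)
    · intro x hx
      have e : (1 + x) ^ (2 * b + 1 - 1) = (1 + x) ^ (2 * b + 1 - 1 - 1) * (1 + x) := by
        rw [← rpow_add_one (by linarith [hx.1])]; congr 1; ring
      have : (-b * ((2 * b + 1) * (1 + x) ^ (2 * b + 1 - 1))
        + (-b * ((2 * b + 1) * (1 + x) ^ (2 * b + 1 - 1)) +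
       (1 - b * x) * ((2 * b + 1) * ((2 * b + 1 - 1) * (1 + x) ^ (2 * b + 1 - 1 - 1))))) =
         -((2 * b + 1) * (2 * b * (1 + b))) * (1 + x) ^ (2 * b + 1 - 1 - 1) * x := by
        rw [e]; ring
      rw [this, abs_mul, abs_mul, abs_neg, abs_of_nonneg hx.1, pow_one]
      have := hCb x hx
      have := hx.1
      gcongr

/-! ### Asymptotics of the model coefficients -/

/-- The constant in the asymptotics of the Fourier coefficients of `sinPow β`. -/
def sinPowConst (β : ℝ) : ℝ := -(Gamma (β + 1) * sin (π * (β / 2)) / π)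

/-- The iterated recurrence, arranged as the two products occurring in Euler's limit for Γ(-β/2) and
Γ(β/2+1). -/
theorem sinPowCoeff_succ_eq_prod {β : ℝ} (hβ : 0 < β) (n : ℕ) :
    sinPowCoeff β (n + 1) = sinPowCoeff β 0 *
      ((∏ j ∈ Finset.range (n + 1), (-(β / 2) + j)) /
        ∏ j ∈ Finset.range (n + 1), (β / 2 + 1 + j)) := by
  induction n with
  | zero =>
    have h := sinPowCoeff_succ hβ 0
    simp only [Nat.cast_zero, zero_add, Finset.prod_range_one, add_zero] at h ⊢
    have : β / 2 + 1 ≠ 0 := by positivity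
    field_simp
    linear_combination 2 * h
  | succ n ih =>
    have h := sinPowCoeff_succ hβ (n + 1)
    rw [Finset.prod_range_succ, Finset.prod_range_succ _ (n + 1)]
    have h1 : ((n + 1 : ℕ) : ℝ) + 1 + β / 2 ≠ 0 := by positivity
    have h2 : ∏ j ∈ Finset.range (n + 1), (β / 2 + 1 + (j : ℝ)) ≠ 0 :=
      Finset.prod_ne_zero_iff.2 fun j _ => by positivity
    have e : sinPowCoeff β ((n + 1 : ℕ) : ℤ) = sinPowCoeff β (n + 1) := by push_cast; rfl
    rw [e, ih] at h
    rw [mul_div_mul_comm]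
    have h3 : β / 2 + 1 + ((n + 1 : ℕ) : ℝ) ≠ 0 := by positivity
    have : sinPowCoeff β (((n + 1 : ℕ) : ℤ) + 1) =
      (((n + 1 : ℕ) : ℝ) - β / 2) * (sinPowCoeff β 0 *
      ((∏ j ∈ Finset.range (n + 1), (-(β / 2) + j)) /
        ∏ j ∈ Finset.range (n + 1), (β / 2 + 1 + j))) / (((n + 1 : ℕ) : ℝ) + 1 + β / 2) := by
      rw [eq_div_iff h1, ← h]; ring
    rw [this, show β / 2 + 1 + ((n + 1 : ℕ) : ℝ) = ((n + 1 : ℕ) : ℝ) + 1 + β / 2 by ring]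
    ring

/-- A quotient of two Euler sequences tends to Γ(β/2+1)/Γ(-β/2), and reflection turns 1/Γ(-β/2) into
a sine. Excluding even β keeps -β/2 away from the poles of Γ. -/
theorem tendsto_sinPowCoeff_succ_mul {β : ℝ} (hβ : 0 < β) (hb : ∀ j : ℤ, β ≠ 2 * (j : ℝ)) :
    Tendsto (fun n : ℕ => sinPowCoeff β (n + 1) * (n : ℝ) ^ (β + 1)) atTop
      (𝓝 (sinPowConst β)) := by
  have hG1 : Gamma (β / 2 + 1) ≠ 0 := (Gamma_pos_of_pos (by positivity)).ne'
  have hG2 : Gamma (-(β / 2)) ≠ 0 := by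
    refine Gamma_ne_zero fun m hm => hb m ?_
    push_cast
    linarith
  have h := ((GammaSeq_tendsto_Gamma (β / 2 + 1)).div (GammaSeq_tendsto_Gamma (-(β / 2)))
    hG2).const_mul (sinPowCoeff β 0)
  have hs := Gamma_mul_Gamma_one_sub (-(β / 2))
  have hlim : sinPowCoeff β 0 * (Gamma (β / 2 + 1) / Gamma (-(β / 2))) = sinPowConst β := by
    rw [sinPowCoeff_zero hβ, sinPowConst]
    rw [show 1 - -(β / 2) = β / 2 + 1 by ring, mul_neg, sin_neg] at hs
    have hsin : sin (π * (β / 2)) ≠ 0 := by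
      intro h0
      rw [h0] at hs
      simp [hG1, hG2] at hs
    have := pi_pos.ne'
    generalize sin (π * (β / 2)) = S at *
    generalize Gamma (β / 2 + 1) = G₁ at *
    generalize Gamma (-(β / 2)) = G₂ at *
    have hs' : G₂ * G₁ * S = -π := by rw [hs]; field_simp
    field_simp
    linear_combination hs'
  rw [hlim] at h
  refine h.congr' ?_
  filter_upwards [eventually_ge_atTop 1] with n hn
  have hn0 : (0 : ℝ) < n := by exact_mod_cast hn
  rw [sinPowCoeff_succ_eq_prod hβ]
  simp only [Pi.div_apply, GammaSeq]
  have e : (n : ℝ) ^ (β + 1) = (n : ℝ) ^ (β / 2 + 1) / (n : ℝ) ^ (-(β / 2)) := by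
    rw [← rpow_sub hn0]; congr 1; ring
  rw [e]
  have h2 : ∏ j ∈ Finset.range (n + 1), (β / 2 + 1 + (j : ℝ)) ≠ 0 :=
    Finset.prod_ne_zero_iff.2 fun j _ => by positivity
  have h3 : ∏ j ∈ Finset.range (n + 1), (-(β / 2) + (j : ℝ)) ≠ 0 := by
    refine Finset.prod_ne_zero_iff.2 fun j _ h0 => hb j ?_
    push_cast
    linarith
  have h4 : (n.factorial : ℝ) ≠ 0 := by positivity
  have h5 : (n : ℝ) ^ (-(β / 2)) ≠ 0 := by positivity
  field_simp

/-- The normalised sequence r n = c_n n^(β+1) converges and has increments O(n^(-3)), hence reaches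
its limit at rate n^(-2). -/
theorem sinPowCoeff_isBigO {β : ℝ} (hβ : 0 < β) (hb : ∀ j : ℤ, β ≠ 2 * (j : ℝ)) :
    (fun n : ℕ => sinPowCoeff β n - sinPowConst β * (n : ℝ) ^ (-β - 1))
      =O[atTop] fun n : ℕ => (n : ℝ) ^ (-β - 3) := by
  set r : ℕ → ℝ := fun n => sinPowCoeff β n * (n : ℝ) ^ (β + 1) with hr
  have hlim : Tendsto r atTop (𝓝 (sinPowConst β)) := by
    rw [← tendsto_add_atTop_iff_nat 1]
    have h1 : Tendsto (fun n : ℕ => (1 + 1 / (n : ℝ)) ^ (β + 1)) atTop (𝓝 1) := by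
      have := (tendsto_one_div_atTop_nhds_zero_nat (𝕜 := ℝ)).const_add 1
      have h2 := this.rpow_const (p := β + 1) (Or.inl (by simp))
      simpa using h2
    have h2 := (tendsto_sinPowCoeff_succ_mul hβ hb).mul h1
    rw [mul_one] at h2
    refine h2.congr' ?_
    filter_upwards [eventually_ge_atTop 1] with n hn
    have hn0 : (0 : ℝ) < n := by exact_mod_cast hn
    simp only [hr]
    rw [mul_assoc, ← mul_rpow hn0.le (by positivity)]
    push_cast
    congr 2
    field_simp
  obtain ⟨C, hC, hCb⟩ := exists_abs_sinPow_ratio_le (β / 2)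
  -- By the recurrence each increment is r n times the cubic remainder at x = 1/n, over a
  -- denominator at least 1; r is bounded because it converges.
  have hstep : (fun n : ℕ => (r n - sinPowConst β) - (r (n + 1) - sinPowConst β)) =O[atTop]
      fun n : ℕ => (n : ℝ) ^ (-(2 : ℝ) - 1) := by
    have hO : r =O[atTop] fun _ => (1 : ℝ) := hlim.isBigO_one ℝ
    have hO2 : (fun n : ℕ => r n * (n : ℝ) ^ (-(2 : ℝ) - 1)) =O[atTop]
        fun n : ℕ => (n : ℝ) ^ (-(2 : ℝ) - 1) := by
      simpa using hO.mul (isBigO_refl (fun n : ℕ => (n : ℝ) ^ (-(2 : ℝ) - 1)) atTop)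
    refine IsBigO.trans (IsBigO.of_bound C ?_) hO2
    filter_upwards [eventually_ge_atTop 1] with n hn
    have hn1 : (1 : ℝ) ≤ n := by exact_mod_cast hn
    have hn0 : (0 : ℝ) < n := by linarith
    have hx : (1 / n : ℝ) ∈ Set.Icc (0 : ℝ) 1 :=
      ⟨by positivity, by rw [div_le_one hn0]; exact hn1⟩
    have hc := hCb _ hx
    rw [show 2 * (β / 2) + 1 = β + 1 by ring] at hc
    have hden : (0 : ℝ) < 1 + (1 + β / 2) * (1 / n) := by positivity
    have hrec := sinPowCoeff_succ hβ n
    have hpow : ((n : ℝ) + 1) ^ (β + 1) = (n : ℝ) ^ (β + 1) * (1 + 1 / n) ^ (β + 1) := by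
      rw [← mul_rpow hn0.le (by positivity)]; congr 1; field_simp
    have hk : (n : ℝ) + 1 + β / 2 = n * (1 + (1 + β / 2) * (1 / n)) := by field_simp; ring
    have hk2 : (n : ℝ) - β / 2 = n * (1 - β / 2 * (1 / n)) := by field_simp
    have hc1 : sinPowCoeff β (n + 1) =
        (1 - β / 2 * (1 / n)) / (1 + (1 + β / 2) * (1 / n)) * sinPowCoeff β n := by
      rw [hk, hk2, mul_assoc, mul_assoc] at hrec
      have := mul_left_cancel₀ hn0.ne' hrec
      rw [div_mul_eq_mul_div, eq_div_iff hden.ne', ← this]; ring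
    have hkey : (r n - sinPowConst β) - (r (n + 1) - sinPowConst β) =
        -(r n * (((1 - β / 2 * (1 / n)) * (1 + 1 / n) ^ (β + 1) - (1 + (1 + β / 2) * (1 / n)))
          / (1 + (1 + β / 2) * (1 / n)))) := by
      simp only [hr]
      push_cast
      rw [hpow, hc1]
      field_simp
      ring
    rw [hkey, norm_neg, norm_mul, norm_mul (r n), mul_left_comm C]
    refine mul_le_mul_of_nonneg_left ?_ (norm_nonneg _)
    rw [norm_div, norm_eq_abs, norm_eq_abs, abs_of_pos hden,
      norm_of_nonneg (by positivity : (0 : ℝ) ≤ (n : ℝ) ^ (-(2 : ℝ) - 1))]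
    have e3 : (n : ℝ) ^ (-(2 : ℝ) - 1) = (1 / n) ^ 3 := by
      rw [show (-(2 : ℝ) - 1) = -((3 : ℕ) : ℝ) by norm_num, rpow_neg hn0.le, rpow_natCast]
      simp
    rw [e3]
    refine (div_le_self (abs_nonneg _) ?_).trans hc
    have : 0 ≤ (1 + β / 2) * (1 / (n : ℝ)) := by positivity
    linarith
  have h0 : Tendsto (fun n => r n - sinPowConst β) atTop (𝓝 0) := by
    simpa using hlim.sub_const (sinPowConst β)
  have h := isBigO_of_tendsto_zero_of_sub (two_pos) h0 hstep
  have h2 := h.mul (isBigO_refl (fun n : ℕ => (n : ℝ) ^ (-β - 1)) atTop)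
  refine h2.congr' ?_ ?_
  · filter_upwards [eventually_ge_atTop 1] with n hn
    have hn0 : (0 : ℝ) < n := by exact_mod_cast hn
    simp only [hr]
    rw [sub_mul, mul_assoc, ← rpow_add hn0]
    simp
  · filter_upwards [eventually_ge_atTop 1] with n hn
    have hn0 : (0 : ℝ) < n := by exact_mod_cast hn
    rw [← rpow_add hn0]; congr 1; ring

/-! ### Fourier coefficients of smooth periodic functions -/

/-- The Fourier coefficients of a `2π`-periodic function. -/
def fourierCo (h : ℝ → ℂ) (l : ℤ) : ℂ :=
  1 / (2 * π) * ∫ u in -π..π, h u * Complex.exp (-(l * u * Complex.I))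

theorem hasSum_fourierCo {h : ℝ → ℂ} (hc : Continuous h) (hp : Function.Periodic h (2 * π))
    (hs : Summable (fourierCo h)) (u : ℝ) :
    HasSum (fun l : ℤ => fourierCo h l * Complex.exp (l * u * Complex.I)) (h u) := by
  have : Fact (0 < 2 * π) := ⟨two_pi_pos⟩
  let f : C(AddCircle (2 * π), ℂ) := ⟨hp.lift, hc.quotient_liftOn' _⟩
  have hpi : (π : ℂ) ≠ 0 := by exact_mod_cast pi_ne_zero
  have he : ∀ (l : ℤ) (x : ℝ), (fourier l (x : AddCircle (2 * π)) : ℂ)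
      = Complex.exp (l * x * Complex.I) := by
    intro l x
    rw [fourier_coe_apply]
    congr 1
    push_cast
    field_simp
  have hco : fourierCoeff f = fourierCo h := by
    ext l
    rw [fourierCoeff_eq_intervalIntegral f l (-π), fourierCo, show -π + 2 * π = π by ring,
      Complex.real_smul]
    congr 1
    · push_cast; rfl
    · refine intervalIntegral.integral_congr fun x _ => ?_
      simp only [he, smul_eq_mul]
      rw [mul_comm]
      congr 2
      push_cast; ring
  rw [← hco] at hs ⊢
  have := has_pointwise_sum_fourier_series_of_summable hs (u : AddCircle (2 * π))
  simp only [he, smul_eq_mul] at this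
  exact this

theorem fourierCo_deriv {h : ℝ → ℂ} (hd : ContDiff ℝ 1 h) (hp : Function.Periodic h (2 * π))
    (l : ℤ) : fourierCo (deriv h) l = l * Complex.I * fourierCo h l := by
  have he : ∀ u : ℝ, HasDerivAt (fun u : ℝ => Complex.exp (-(l * u * Complex.I)))
      (-(l * Complex.I) * Complex.exp (-(l * u * Complex.I))) u := by
    intro u
    have h1 : HasDerivAt (fun u : ℝ => -((l : ℂ) * u * Complex.I)) (-(l * Complex.I)) u := by
      have := (((hasDerivAt_id u).ofReal_comp.const_mul (l : ℂ)).mul_const Complex.I).neg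
      exact this.congr_deriv (by simp)
    exact h1.cexp.congr_deriv (by ring)
  have hh : ∀ u : ℝ, HasDerivAt h (deriv h u) u := fun u =>
    (hd.differentiable one_ne_zero u).hasDerivAt
  have hcd : Continuous (deriv h) := hd.continuous_deriv le_rfl
  have key := intervalIntegral.integral_deriv_mul_eq_sub (a := -π) (b := π)
    (fun u _ => hh u) (fun u _ => he u) (hcd.intervalIntegrable _ _)
    (Continuous.intervalIntegrable (by fun_prop) _ _)
  have hb : h π * Complex.exp (-(l * π * Complex.I))
      - h (-π) * Complex.exp (-(l * (-π : ℝ) * Complex.I)) = 0 := by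
    have h1 : h π = h (-π) := by
      rw [← hp (-π)]; congr 1; ring
    have h2 : Complex.exp (-(l * (-π : ℝ) * Complex.I))
        = Complex.exp (-(l * π * Complex.I)) := by
      rw [Complex.exp_eq_exp_iff_exists_int]
      exact ⟨l, by push_cast; ring⟩
    rw [h1, h2, sub_self]
  rw [hb, intervalIntegral.integral_add
    (Continuous.intervalIntegrable (by fun_prop) _ _)
    (Continuous.intervalIntegrable (by have := hd.continuous; fun_prop) _ _)] at key
  have e : ∫ u in -π..π, h u * (-(l * Complex.I) * Complex.exp (-(l * u * Complex.I)))
      = -(l * Complex.I) * ∫ u in -π..π, h u * Complex.exp (-(l * u * Complex.I)) := by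
    rw [← intervalIntegral.integral_const_mul]
    refine intervalIntegral.integral_congr fun u _ => ?_
    ring
  rw [e] at key
  simp only [fourierCo]
  linear_combination (1 / (2 * π : ℂ)) * key

theorem norm_cexp_neg_int_mul (l : ℤ) (u : ℝ) : ‖Complex.exp (-(l * u * Complex.I))‖ = 1 := by
  have : (-(l * u * Complex.I) : ℂ) = ((-(l * u) : ℝ) : ℂ) * Complex.I := by push_cast; ring
  rw [this, Complex.norm_exp_ofReal_mul_I]

theorem norm_cexp_int_mul (l : ℤ) (u : ℝ) : ‖Complex.exp (l * u * Complex.I)‖ = 1 := by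
  have : (l * u * Complex.I : ℂ) = ((l * u : ℝ) : ℂ) * Complex.I := by push_cast; ring
  rw [this, Complex.norm_exp_ofReal_mul_I]

theorem exists_pow_mul_norm_fourierCo_le (M : ℕ) : ∀ {h : ℝ → ℂ}, ContDiff ℝ M h →
    Function.Periodic h (2 * π) →
    ∃ C : ℝ, ∀ l : ℤ, |(l : ℝ)| ^ M * ‖fourierCo h l‖ ≤ C := by
  induction M with
  | zero =>
    intro h hd hp
    have hc : Continuous h := hd.continuous
    obtain ⟨B, hB⟩ := isCompact_uIcc.exists_bound_of_continuousOn (s := Set.uIcc (-π) π)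
      hc.continuousOn
    refine ⟨‖(1 / (2 * π) : ℂ)‖ * (B * |π - -π|), fun l => ?_⟩
    rw [pow_zero, one_mul, fourierCo, norm_mul]
    refine mul_le_mul_of_nonneg_left ?_ (norm_nonneg _)
    refine intervalIntegral.norm_integral_le_of_norm_le_const fun u hu => ?_
    rw [norm_mul, norm_cexp_neg_int_mul, mul_one]
    exact hB u (Set.uIoc_subset_uIcc hu)
  | succ M ih =>
    intro h hd hp
    have hd' : ContDiff ℝ M (deriv h) := by
      have := hd
      rw [show ((M + 1 : ℕ) : WithTop ℕ∞) = (M : WithTop ℕ∞) + 1 by push_cast; rfl,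
        contDiff_succ_iff_deriv] at this
      exact this.2.2
    have hp' : Function.Periodic (deriv h) (2 * π) := by
      intro u
      rw [← deriv_comp_add_const]
      congr 1
      exact funext hp
    obtain ⟨C, hC⟩ := ih hd' hp'
    refine ⟨C, fun l => le_trans (le_of_eq ?_) (hC l)⟩
    have hd1 : ContDiff ℝ 1 h := hd.of_le (by
      rw [show ((M + 1 : ℕ) : WithTop ℕ∞) = (M : WithTop ℕ∞) + 1 by push_cast; rfl]
      exact le_add_self)
    rw [fourierCo_deriv hd1 hp, norm_mul, norm_mul, Complex.norm_I, mul_one,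
      Complex.norm_intCast, pow_succ, mul_assoc]

/-- Of the q + 2 derivatives, q pay for the weight and two for the summability of l^(-2). -/
theorem summable_fourierCo_mul {h : ℝ → ℂ} (q : ℕ) (hd : ContDiff ℝ (q + 2 : ℕ) h)
    (hp : Function.Periodic h (2 * π)) :
    Summable fun l : ℤ => ‖fourierCo h l‖ * (1 + |(l : ℝ)|) ^ q := by
  obtain ⟨C, hC⟩ := exists_pow_mul_norm_fourierCo_le (q + 2) hd hp
  have hs : Summable fun l : ℤ => 2 ^ q * C * (1 / (l : ℝ) ^ 2) :=
    (Real.summable_one_div_int_pow.2 one_lt_two).mul_left _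
  refine Summable.of_norm_bounded_eventually hs ?_
  have : ({0}ᶜ : Set ℤ) ∈ (cofinite : Filter ℤ) := (Set.finite_singleton 0).compl_mem_cofinite
  filter_upwards [this] with l hl
  have hl0 : l ≠ 0 := hl
  have hl1 : (1 : ℝ) ≤ |(l : ℝ)| := by
    exact_mod_cast Int.one_le_abs hl0
  have hl2 : (0 : ℝ) < (l : ℝ) ^ 2 := by positivity
  rw [norm_of_nonneg (by positivity), ← mul_div_assoc, mul_one, le_div_iff₀ hl2, ← sq_abs]
  calc ‖fourierCo h l‖ * (1 + |(l : ℝ)|) ^ q * |(l : ℝ)| ^ 2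
      ≤ ‖fourierCo h l‖ * (2 * |(l : ℝ)|) ^ q * |(l : ℝ)| ^ 2 := by gcongr; linarith
    _ = 2 ^ q * (|(l : ℝ)| ^ (q + 2) * ‖fourierCo h l‖) := by rw [mul_pow, pow_add]; ring
    _ ≤ 2 ^ q * C := by gcongr; exact hC l

theorem integral_even_mul_cexp {h : ℝ → ℝ} (hc : Continuous h) (he : ∀ u, h (-u) = h u) (j : ℤ) :
    ∫ u in -π..π, (h u : ℂ) * Complex.exp (-(j * u * Complex.I))
      = ((∫ u in -π..π, h u * cos (j * u) : ℝ) : ℂ) := by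
  set g : ℝ → ℂ := fun u => (h u : ℂ) * Complex.exp (-(j * u * Complex.I)) with hg
  have hgc : Continuous g := by
    rw [hg]
    exact (Complex.continuous_ofReal.comp hc).mul (by fun_prop)
  have h1 : ∫ u in -π..π, g (-u) = ∫ u in -π..π, g u := by
    rw [intervalIntegral.integral_comp_neg, neg_neg]
  have h2 : ∫ u in -π..π, (g u + g (-u)) = 2 * ∫ u in -π..π, g u := by
    rw [intervalIntegral.integral_add (hgc.intervalIntegrable _ _)
      (Continuous.intervalIntegrable (by fun_prop) _ _), h1]
    ring
  have h3 : ∫ u in -π..π, (g u + g (-u))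
      = ((∫ u in -π..π, 2 * (h u * cos (j * u)) : ℝ) : ℂ) := by
    rw [← intervalIntegral.integral_ofReal]
    refine intervalIntegral.integral_congr fun u _ => ?_
    simp only [hg, he]
    push_cast
    rw [← mul_add, Complex.cos]
    have e1 : Complex.exp (-(j * -u * Complex.I)) = Complex.exp (j * u * Complex.I) := by
      congr 1; ring
    have e2 : Complex.exp (-(j * u * Complex.I)) = Complex.exp (-(j * u) * Complex.I) := by
      congr 1; ring
    rw [e1, e2]
    ring
  rw [intervalIntegral.integral_const_mul] at h3
  rw [h3] at h2
  push_cast at h2 ⊢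
  linear_combination (-1 / 2 : ℂ) * h2

/-! ### Products of the model singularity with a smooth function -/

theorem integral_sinPow_mul_cexp {β : ℝ} (hβ : 0 < β) (j : ℤ) :
    ∫ u in -π..π, (sinPow β u : ℂ) * Complex.exp (-(j * u * Complex.I))
      = 2 * π * sinPowCoeff β j := by
  have hpi : (π : ℂ) ≠ 0 := by exact_mod_cast pi_ne_zero
  rw [integral_even_mul_cexp (continuous_sinPow hβ) (sinPow_neg β), sinPowCoeff]
  push_cast
  field_simp

theorem fourierCo_sinPow_sub {β : ℝ} (hβ : 0 < β) (τ : ℝ) (j : ℤ) :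
    fourierCo (fun u => (sinPow β (u - τ) : ℂ)) j
      = Complex.exp (-(j * τ * Complex.I)) * sinPowCoeff β j := by
  set g : ℝ → ℂ := fun u => (sinPow β u : ℂ) * Complex.exp (-(j * u * Complex.I)) with hg
  have hgp : Function.Periodic g (2 * π) := by
    intro u
    simp only [hg]
    rw [sinPow_periodic β u]
    congr 1
    rw [Complex.exp_eq_exp_iff_exists_int]
    exact ⟨-j, by push_cast; ring⟩
  have h1 : ∫ u in -π..π, (sinPow β (u - τ) : ℂ) * Complex.exp (-(j * u * Complex.I))
      = Complex.exp (-(j * τ * Complex.I)) * ∫ u in -π..π, g (u - τ) := by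
    rw [← intervalIntegral.integral_const_mul]
    refine intervalIntegral.integral_congr fun u _ => ?_
    simp only [hg]
    rw [mul_left_comm, ← Complex.exp_add]
    congr 2
    push_cast; ring
  have h2 : ∫ u in -π..π, g (u - τ) = ∫ u in -π..π, g u := by
    rw [intervalIntegral.integral_comp_sub_right]
    have := hgp.intervalIntegral_add_eq (-π - τ) (-π)
    rw [show -π - τ + 2 * π = π - τ by ring, show -π + 2 * π = π by ring] at this
    exact this
  have hpi : (π : ℂ) ≠ 0 := by exact_mod_cast pi_ne_zero
  rw [fourierCo, h1, h2, hg, integral_sinPow_mul_cexp hβ]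
  field_simp

/-- The convolution formula: the Fourier series of ψ is integrated term by term, dominated by its
absolutely summable coefficients. -/
theorem hasSum_fourierCo_sinPow_mul {β : ℝ} (hβ : 0 < β) (τ : ℝ) {ψ : ℝ → ℂ}
    (hc : Continuous ψ) (hp : Function.Periodic ψ (2 * π)) (hs : Summable (fourierCo ψ)) (k : ℤ) :
    HasSum (fun l : ℤ => Complex.exp (-(k * τ * Complex.I)) *
        (fourierCo ψ l * Complex.exp (l * τ * Complex.I) * sinPowCoeff β (k - l)))
      (fourierCo (fun u => (sinPow β (u - τ) : ℂ) * ψ u) k) := by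
  have hcs : Continuous fun u => (sinPow β (u - τ) : ℂ) :=
    Complex.continuous_ofReal.comp ((continuous_sinPow hβ).comp (by fun_prop))
  have key := intervalIntegral.hasSum_integral_of_dominated_convergence (a := -π) (b := π)
    (μ := volume)
    (F := fun (l : ℤ) u => (sinPow β (u - τ) : ℂ) *
      (fourierCo ψ l * Complex.exp (l * u * Complex.I)) * Complex.exp (-(k * u * Complex.I)))
    (f := fun u => (sinPow β (u - τ) : ℂ) * ψ u * Complex.exp (-(k * u * Complex.I)))
    (fun l u => ‖(sinPow β (u - τ) : ℂ)‖ * ‖fourierCo ψ l‖)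
    (fun l => by
      refine Continuous.aestronglyMeasurable ?_
      exact (hcs.mul (by fun_prop)).mul (by fun_prop))
    (fun l => Eventually.of_forall fun u _ => by
      rw [norm_mul, norm_cexp_neg_int_mul, mul_one, norm_mul, norm_mul, norm_cexp_int_mul,
        mul_one])
    (Eventually.of_forall fun u _ => hs.norm.mul_left _)
    (by
      simp_rw [tsum_mul_left]
      exact (hcs.norm.mul continuous_const).intervalIntegrable _ _)
    (Eventually.of_forall fun u _ =>
      ((hasSum_fourierCo hc hp hs u).mul_left _).mul_right _)
  have h2 := key.mul_left (1 / (2 * π) : ℂ)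
  have e1 : fourierCo (fun u => (sinPow β (u - τ) : ℂ) * ψ u) k = 1 / (2 * π : ℂ) *
      ∫ u in -π..π, (sinPow β (u - τ) : ℂ) * ψ u * Complex.exp (-(k * u * Complex.I)) := rfl
  rw [e1]
  convert! h2 using 2 with l
  have h3 := fourierCo_sinPow_sub hβ τ (k - l)
  have e2 : ∫ u in -π..π, (sinPow β (u - τ) : ℂ) *
      (fourierCo ψ l * Complex.exp (l * u * Complex.I)) * Complex.exp (-(k * u * Complex.I))
      = fourierCo ψ l * ∫ u in -π..π, (sinPow β (u - τ) : ℂ) *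
        Complex.exp (-((k - l : ℤ) * u * Complex.I)) := by
    rw [← intervalIntegral.integral_const_mul]
    refine intervalIntegral.integral_congr fun u _ => ?_
    have : Complex.exp (-((k - l : ℤ) * u * Complex.I))
        = Complex.exp (l * u * Complex.I) * Complex.exp (-(k * u * Complex.I)) := by
      rw [← Complex.exp_add]; congr 1; push_cast; ring
    rw [this]; ring
  have e3 : Complex.exp (-((k - l : ℤ) * τ * Complex.I))
      = Complex.exp (-(k * τ * Complex.I)) * Complex.exp (l * τ * Complex.I) := by
    rw [← Complex.exp_add]; congr 1; push_cast; ring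
  rw [fourierCo, e3] at h3
  rw [e2]
  linear_combination (-fourierCo ψ l) * h3

/-- Second order Taylor bound for `(1 - x) ^ (-s)`. -/
theorem exists_abs_one_sub_rpow_neg_sub_le {s : ℝ} (hs : 0 < s) : ∃ C : ℝ, 0 ≤ C ∧
    ∀ x ∈ Set.Icc (-(1 / 2) : ℝ) (1 / 2), |(1 - x) ^ (-s) - 1 - s * x| ≤ C * |x| ^ 2 := by
  have hd : ∀ p : ℝ, ∀ x ∈ Set.Icc (-(1 / 2) : ℝ) (1 / 2),
      HasDerivAt (fun x : ℝ => (1 - x) ^ p) (-p * (1 - x) ^ (p - 1)) x := by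
    intro p x hx
    have h := ((hasDerivAt_id x).const_sub 1).rpow_const (p := p)
      (Or.inl (by simp; linarith [hx.2]))
    exact h.congr_deriv (by simp)
  have h0 : (0 : ℝ) ∈ Set.Icc (-(1 / 2) : ℝ) (1 / 2) := by constructor <;> norm_num
  refine ⟨s * (s + 1) * (1 / 2) ^ (-s - 1 - 1), by positivity, ?_⟩
  refine abs_le_of_abs_deriv_le_abs_pow (h' := fun x => s * (1 - x) ^ (-s - 1) - s)
    Set.ordConnected_Icc h0 (by positivity) (by simp) ?_ ?_
  · intro x hx
    have := ((hd (-s) x hx).sub_const 1).sub ((hasDerivAt_id x).const_mul s)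
    exact this.congr_deriv (by simp)
  · refine abs_le_of_abs_deriv_le_abs_pow (n := 0)
      (h' := fun x => s * (-(-s - 1) * (1 - x) ^ (-s - 1 - 1)))
      Set.ordConnected_Icc h0 (by positivity) (by simp) ?_ ?_
    · intro x hx
      exact ((hd (-s - 1) x hx).const_mul s).sub_const s
    · intro x hx
      have h1 : (1 - x) ^ (-s - 1 - 1) ≤ (1 / 2 : ℝ) ^ (-s - 1 - 1) :=
        rpow_le_rpow_of_nonpos (by norm_num) (by linarith [hx.2]) (by linarith)
      have h2 : (0 : ℝ) ≤ (1 - x) ^ (-s - 1 - 1) := rpow_nonneg (by linarith [hx.2]) _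
      rw [abs_of_nonneg (by rw [neg_sub, sub_neg_eq_add]; positivity), pow_zero, mul_one,
        mul_assoc]
      refine mul_le_mul_of_nonneg_left ?_ hs.le
      rw [show -(-s - 1) = s + 1 by ring]
      gcongr

theorem rpow_neg_natCast_le_one {p : ℝ} (hp : 0 ≤ p) {k : ℕ} (hk : 1 ≤ k) : (k : ℝ) ^ (-p) ≤ 1 :=
  rpow_le_one_of_one_le_of_nonpos (by exact_mod_cast hk) (by linarith)

theorem exists_bound_of_isBigO_nat {c : ℕ → ℝ} {p : ℝ}
    (hc : c =O[atTop] fun n : ℕ => (n : ℝ) ^ p) :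
    ∃ C : ℝ, 0 ≤ C ∧ ∀ n : ℕ, 1 ≤ n → |c n| ≤ C * (n : ℝ) ^ p := by
  have h := hc.comp_tendsto (tendsto_add_atTop_nat 1)
  rw [isBigO_nat_atTop_iff (fun x hx => by
    have : (0 : ℝ) < ((x + 1 : ℕ) : ℝ) ^ p := by positivity
    exact absurd hx this.ne')] at h
  obtain ⟨C, hC⟩ := h
  refine ⟨|C|, abs_nonneg _, fun n hn => ?_⟩
  obtain ⟨m, rfl⟩ : ∃ m, n = m + 1 := ⟨n - 1, by omega⟩
  have h1 := hC m
  simp only [Function.comp_apply, norm_eq_abs] at h1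
  rw [abs_of_nonneg (by positivity : (0 : ℝ) ≤ ((m + 1 : ℕ) : ℝ) ^ p)] at h1
  exact h1.trans (mul_le_mul_of_nonneg_right (le_abs_self C) (by positivity))

/-- A sequence with a two-sided shift expansion: if `c n = L n ^ (-s) + O(n ^ (-s - 2))` then
`c (k - l)` is expanded to second order in `l / k` with polynomial loss in `l`. -/
theorem exists_shift_bound {c : ℤ → ℝ} {s L B : ℝ} (hs : 0 < s) (hB : ∀ j, |c j| ≤ B)
    (hc : (fun n : ℕ => c n - L * (n : ℝ) ^ (-s)) =O[atTop] fun n : ℕ => (n : ℝ) ^ (-s - 2)) :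
    ∃ C : ℝ, ∀ k : ℕ, 1 ≤ k → ∀ l : ℤ,
      |c (k - l) - L * (k : ℝ) ^ (-s) - L * s * l * (k : ℝ) ^ (-s - 1)|
        ≤ C * (1 + |(l : ℝ)|) ^ (⌈s⌉₊ + 3) * (k : ℝ) ^ (-s - 2) := by
  obtain ⟨C₁, hC₁, h₁⟩ := exists_bound_of_isBigO_nat hc
  obtain ⟨C₂, hC₂, h₂⟩ := exists_abs_one_sub_rpow_neg_sub_le hs
  have hB0 : 0 ≤ B := (abs_nonneg _).trans (hB 0)
  set K₁ := C₁ * 2 ^ (s + 2) + |L| * C₂ with hK₁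
  set K₂ := (B + |L| + |L| * s) * 2 ^ (s + 2) with hK₂
  have hK₁0 : 0 ≤ K₁ := by positivity
  have hK₂0 : 0 ≤ K₂ := by positivity
  refine ⟨K₁ + K₂, fun k hk l => ?_⟩
  have hk1 : (1 : ℝ) ≤ k := by exact_mod_cast hk
  have hk0 : (0 : ℝ) < k := by linarith
  have hl1 : (1 : ℝ) ≤ 1 + |(l : ℝ)| := by linarith [abs_nonneg (l : ℝ)]
  have hpk : (0 : ℝ) < (k : ℝ) ^ (-s - 2) := by positivity
  -- For 2|l| ≤ k the index k - l is at least k/2, so the asymptotics of c and the Taylor bound at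
  -- l/k both apply. For larger |l| every term is bounded crudely, and the powers of k are paid for
  -- by powers of l.
  rcases le_or_gt (2 * |(l : ℝ)|) k with hlk | hlk
  · have hlk' := abs_le.1 (show |(l : ℝ)| ≤ k / 2 by linarith)
    have hnpos : (0 : ℤ) ≤ (k : ℤ) - l := by
      have : (l : ℝ) ≤ k := by linarith
      have : l ≤ (k : ℤ) := by exact_mod_cast this
      omega
    obtain ⟨n, hn⟩ := Int.eq_ofNat_of_zero_le hnpos
    have hnr : (n : ℝ) = k - l := by
      have : ((n : ℤ) : ℝ) = ((k : ℤ) - l : ℤ) := by rw [hn]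
      push_cast at this; exact this
    have hn2 : (k : ℝ) / 2 ≤ n := by linarith
    have hn1 : 1 ≤ n := by
      have : (0 : ℝ) < n := by linarith
      exact_mod_cast this
    have hn0 : (0 : ℝ) < n := by linarith
    have hx : (l : ℝ) / k ∈ Set.Icc (-(1 / 2) : ℝ) (1 / 2) := by
      constructor
      · rw [le_div_iff₀ hk0]; linarith
      · rw [div_le_iff₀ hk0]; linarith
    have e1 : (n : ℝ) ^ (-s) = (k : ℝ) ^ (-s) * (1 - l / k) ^ (-s) := by
      rw [← mul_rpow hk0.le (by linarith [hx.2]), hnr]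
      congr 1; field_simp
    have e2 : (k : ℝ) ^ (-s - 1) = (k : ℝ) ^ (-s) / k := rpow_sub_one hk0.ne' _
    have e3 : (k : ℝ) ^ (-s - 2) = (k : ℝ) ^ (-s) / k ^ 2 := by
      rw [rpow_sub hk0]; norm_cast
    have e4 : (n : ℝ) ^ (-s - 2) ≤ 2 ^ (s + 2) * (k : ℝ) ^ (-s - 2) := by
      calc (n : ℝ) ^ (-s - 2) ≤ ((k : ℝ) / 2) ^ (-s - 2) :=
            rpow_le_rpow_of_nonpos (by positivity) hn2 (by linarith)
        _ = 2 ^ (s + 2) * (k : ℝ) ^ (-s - 2) := by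
            rw [div_rpow hk0.le zero_le_two, show -s - 2 = -(s + 2) by ring, rpow_neg zero_le_two]
            field_simp
    have e5 : c (k - l) - L * (k : ℝ) ^ (-s) - L * s * l * (k : ℝ) ^ (-s - 1)
        = (c n - L * (n : ℝ) ^ (-s))
          + L * (k : ℝ) ^ (-s) * ((1 - l / k) ^ (-s) - 1 - s * (l / k)) := by
      rw [e1, e2, hn]; ring
    have e6 : |L * (k : ℝ) ^ (-s) * ((1 - l / k) ^ (-s) - 1 - s * (l / k))|
        ≤ |L| * C₂ * |(l : ℝ)| ^ 2 * (k : ℝ) ^ (-s - 2) := by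
      rw [abs_mul, abs_mul, abs_of_pos (by positivity : (0 : ℝ) < (k : ℝ) ^ (-s)), e3]
      calc |L| * (k : ℝ) ^ (-s) * |(1 - l / k : ℝ) ^ (-s) - 1 - s * (l / k)|
          ≤ |L| * (k : ℝ) ^ (-s) * (C₂ * |(l / k : ℝ)| ^ 2) := by
            gcongr; exact h₂ _ hx
        _ = _ := by
            rw [abs_div, abs_of_pos hk0]; field_simp
    have e7 : |(l : ℝ)| ^ 2 ≤ (1 + |(l : ℝ)|) ^ (⌈s⌉₊ + 3) :=
      (pow_le_pow_left₀ (abs_nonneg _) (by linarith) 2).trans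
        (pow_le_pow_right₀ hl1 (by omega))
    have e8 : (1 : ℝ) ≤ (1 + |(l : ℝ)|) ^ (⌈s⌉₊ + 3) := one_le_pow₀ hl1
    rw [e5]
    calc _ ≤ _ := abs_add_le _ _
      _ ≤ C₁ * (n : ℝ) ^ (-s - 2) + |L| * C₂ * |(l : ℝ)| ^ 2 * (k : ℝ) ^ (-s - 2) :=
          add_le_add (h₁ n hn1) e6
      _ ≤ C₁ * (2 ^ (s + 2) * (k : ℝ) ^ (-s - 2)) * (1 + |(l : ℝ)|) ^ (⌈s⌉₊ + 3)
          + |L| * C₂ * (1 + |(l : ℝ)|) ^ (⌈s⌉₊ + 3) * (k : ℝ) ^ (-s - 2) := by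
          refine add_le_add ?_ (by gcongr)
          exact (mul_le_mul_of_nonneg_left e4 hC₁).trans
            (le_mul_of_one_le_right (by positivity) e8)
      _ = K₁ * (1 + |(l : ℝ)|) ^ (⌈s⌉₊ + 3) * (k : ℝ) ^ (-s - 2) := by rw [hK₁]; ring
      _ ≤ _ := by gcongr; linarith
  -- Here k < 2(1 + |l|), so k^(s+2) is at most a polynomial in |l| of degree ⌈s⌉ + 2; the term
  -- linear in l uses one further power, hence the exponent ⌈s⌉ + 3.
  · have e1 : (1 : ℝ) ≤ 2 ^ (s + 2) * (1 + |(l : ℝ)|) ^ (⌈s⌉₊ + 2) * (k : ℝ) ^ (-s - 2) := by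
      have h1 : (k : ℝ) ^ (s + 2) ≤ 2 ^ (s + 2) * (1 + |(l : ℝ)|) ^ (⌈s⌉₊ + 2) := by
        calc (k : ℝ) ^ (s + 2) ≤ (2 * (1 + |(l : ℝ)|)) ^ (s + 2) :=
              rpow_le_rpow hk0.le (by linarith) (by linarith)
          _ = 2 ^ (s + 2) * (1 + |(l : ℝ)|) ^ (s + 2) := mul_rpow zero_le_two (by linarith)
          _ ≤ 2 ^ (s + 2) * (1 + |(l : ℝ)|) ^ ((⌈s⌉₊ + 2 : ℕ) : ℝ) := by
              refine mul_le_mul_of_nonneg_left (rpow_le_rpow_of_exponent_le hl1 ?_) (by positivity)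
              push_cast; linarith [Nat.le_ceil s]
          _ = _ := by rw [rpow_natCast]
      calc (1 : ℝ) = (k : ℝ) ^ (s + 2) * (k : ℝ) ^ (-s - 2) := by
            rw [← rpow_add hk0]; norm_num
        _ ≤ _ := by gcongr
    have e2 : |c (k - l) - L * (k : ℝ) ^ (-s) - L * s * l * (k : ℝ) ^ (-s - 1)|
        ≤ (B + |L| + |L| * s) * (1 + |(l : ℝ)|) := by
      have a1 : (k : ℝ) ^ (-s) ≤ 1 := rpow_neg_natCast_le_one hs.le hk
      have a2 : (k : ℝ) ^ (-s - 1) ≤ 1 := by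
        rw [show -s - 1 = -(s + 1) by ring]; exact rpow_neg_natCast_le_one (by linarith) hk
      have a3 : (0 : ℝ) ≤ (k : ℝ) ^ (-s) := by positivity
      have a4 : (0 : ℝ) ≤ (k : ℝ) ^ (-s - 1) := by positivity
      calc _ ≤ |c (k - l) - L * (k : ℝ) ^ (-s)| + |L * s * l * (k : ℝ) ^ (-s - 1)| := abs_sub _ _
        _ ≤ (|c (k - l)| + |L * (k : ℝ) ^ (-s)|) + |L * s * l * (k : ℝ) ^ (-s - 1)| := by
            gcongr; exact abs_sub _ _
        _ = |c (k - l)| + |L| * (k : ℝ) ^ (-s) + |L| * s * |(l : ℝ)| * (k : ℝ) ^ (-s - 1) := by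
            rw [abs_mul, abs_mul, abs_mul, abs_mul, abs_of_nonneg a3, abs_of_nonneg a4,
              abs_of_pos hs]
        _ ≤ B + |L| * 1 + |L| * s * |(l : ℝ)| * 1 := by
            gcongr; exact hB _
        _ ≤ _ := by
            have := abs_nonneg (l : ℝ)
            have := abs_nonneg L
            nlinarith [mul_nonneg (abs_nonneg L) hs.le, mul_nonneg hB0 (abs_nonneg (l : ℝ)),
              mul_nonneg (abs_nonneg L) (abs_nonneg (l : ℝ))]
    calc _ ≤ (B + |L| + |L| * s) * (1 + |(l : ℝ)|) := e2
      _ ≤ (B + |L| + |L| * s) * (1 + |(l : ℝ)|) *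
          (2 ^ (s + 2) * (1 + |(l : ℝ)|) ^ (⌈s⌉₊ + 2) * (k : ℝ) ^ (-s - 2)) :=
          le_mul_of_one_le_right (by positivity) e1
      _ = K₂ * (1 + |(l : ℝ)|) ^ (⌈s⌉₊ + 3) * (k : ℝ) ^ (-s - 2) := by
          rw [hK₂, pow_succ (1 + |(l : ℝ)|) (⌈s⌉₊ + 2)]; ring
      _ ≤ _ := by gcongr; linarith

theorem abs_sinPowCoeff_le {β : ℝ} (hβ : 0 < β) : ∃ B : ℝ, ∀ j : ℤ, |sinPowCoeff β j| ≤ B := by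
  obtain ⟨B, hB⟩ := isCompact_uIcc.exists_bound_of_continuousOn (s := Set.uIcc (-π) π)
    (continuous_sinPow hβ).continuousOn
  have hB0 : 0 ≤ B := (norm_nonneg _).trans (hB π Set.right_mem_uIcc)
  refine ⟨|1 / (2 * π)| * (B * |π - -π|), fun j => ?_⟩
  rw [sinPowCoeff, abs_mul]
  refine mul_le_mul_of_nonneg_left ?_ (abs_nonneg _)
  rw [← norm_eq_abs]
  refine intervalIntegral.norm_integral_le_of_norm_le_const fun u hu => ?_
  rw [norm_mul, norm_eq_abs (cos _)]
  calc _ ≤ B * 1 := mul_le_mul (hB u (Set.uIoc_subset_uIcc hu)) (abs_cos_le_one _)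
        (abs_nonneg _) hB0
    _ = B := mul_one B

theorem fourierCo_conj_neg (ψ : ℝ → ℝ) (l : ℤ) :
    fourierCo (fun u => (ψ u : ℂ)) (-l) = (starRingEnd ℂ) (fourierCo (fun u => (ψ u : ℂ)) l) := by
  rw [fourierCo, fourierCo, map_mul]
  congr 1
  · simp [Complex.conj_ofNat]
  · rw [← intervalIntegral.intervalIntegral_conj]
    refine intervalIntegral.integral_congr fun u _ => ?_
    simp only [map_mul, Complex.conj_ofReal, ← Complex.exp_conj, map_neg, Complex.conj_I,
      map_intCast]
    congr 2
    push_cast; ring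

/-- The reindexing l ↦ -l shows that S equals minus its conjugate. For real ψ this removes the
cosine term of order k^(-s-1). -/
theorem hasSum_neg_of_conj {p : ℤ → ℂ} (hp : ∀ l, p (-l) = (starRingEnd ℂ) (p l)) {S : ℂ}
    (hS : HasSum (fun l : ℤ => (l : ℂ) * p l) S) : S.re = 0 := by
  have h1 : HasSum (fun l : ℤ => (starRingEnd ℂ) ((l : ℂ) * p l)) ((starRingEnd ℂ) S) :=
    Complex.hasSum_conj'.2 (by simpa using hS)
  have h2 : HasSum (fun l : ℤ => ((-l : ℤ) : ℂ) * p (-l)) S :=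
    (Equiv.neg ℤ).hasSum_iff.2 hS
  have h3 : HasSum (fun l : ℤ => -(starRingEnd ℂ) ((l : ℂ) * p l)) S := by
    convert! h2 using 2 with l
    rw [hp, map_mul, map_intCast]
    push_cast; ring
  have h4 := h3.unique h1.neg
  have h5 := congrArg Complex.re h4
  simp only [Complex.neg_re, Complex.conj_re] at h5
  linarith

theorem fourierCo_ofReal_re {h : ℝ → ℝ} (hc : Continuous h) (k : ℤ) :
    (fourierCo (fun u => (h u : ℂ)) k).re = 1 / (2 * π) * ∫ u in -π..π, h u * cos (k * u) := by
  have h1 : (1 / (2 * π) : ℂ) = ((1 / (2 * π) : ℝ) : ℂ) := by push_cast; rfl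
  have h2 : IntervalIntegrable (fun u : ℝ => (h u : ℂ) * Complex.exp (-(k * u * Complex.I)))
      volume (-π) π :=
    ((Complex.continuous_ofReal.comp hc).mul (by fun_prop)).intervalIntegrable _ _
  rw [fourierCo, h1, Complex.re_ofReal_mul]
  congr 1
  have h3 := Complex.reCLM.intervalIntegral_comp_comm h2
  simp only [Complex.reCLM_apply] at h3
  rw [← h3]
  refine intervalIntegral.integral_congr fun u _ => ?_
  have e : (-(k * u * Complex.I) : ℂ) = ((-(k * u) : ℝ) : ℂ) * Complex.I := by push_cast; ring
  rw [Complex.re_ofReal_mul, e, Complex.exp_ofReal_mul_I_re, cos_neg]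

/-- Two-term expansion of the Fourier coefficients of a smooth multiple of a translate of
`sinPow β`. -/
theorem exists_fourierCo_expansion {β : ℝ} (hβ : 0 < β) (hb : ∀ j : ℤ, β ≠ 2 * (j : ℝ)) (τ : ℝ)
    {ψ : ℝ → ℝ} (hd : ContDiff ℝ (⌈β + 1⌉₊ + 5 : ℕ) ψ) (hp : Function.Periodic ψ (2 * π)) :
    ∃ σ : ℝ, (fun k : ℕ =>
      1 / (2 * π) * (∫ u in -π..π, sinPow β (u - τ) * ψ u * cos (k * u))
        - (sinPowConst β * ψ τ * cos (k * τ) * (k : ℝ) ^ (-(β + 1))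
          + σ * sin (k * τ) * (k : ℝ) ^ (-(β + 1) - 1)))
      =O[atTop] fun k : ℕ => (k : ℝ) ^ (-(β + 1) - 2) := by
  set L := sinPowConst β
  set s := β + 1 with hs
  have hs0 : 0 < s := by linarith
  set Ψ : ℝ → ℂ := fun u => (ψ u : ℂ) with hΨ
  have hdΨ : ContDiff ℝ (⌈s⌉₊ + 5 : ℕ) Ψ := Complex.ofRealCLM.contDiff.comp hd
  have hpΨ : Function.Periodic Ψ (2 * π) := fun u => by simp only [hΨ, hp u]
  -- The weight lost in the shift bound; q + 2 is the assumed smoothness of ψ.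
  set q := ⌈s⌉₊ + 3 with hq
  have hsum : Summable fun l : ℤ => ‖fourierCo Ψ l‖ * (1 + |(l : ℝ)|) ^ q :=
    summable_fourierCo_mul q hdΨ hpΨ
  have hle : ∀ l : ℤ, (1 : ℝ) ≤ (1 + |(l : ℝ)|) ^ q := fun l =>
    one_le_pow₀ (by linarith [abs_nonneg (l : ℝ)])
  have hle' : ∀ l : ℤ, |(l : ℝ)| ≤ (1 + |(l : ℝ)|) ^ q := fun l =>
    (by linarith : |(l : ℝ)| ≤ 1 + |(l : ℝ)|).trans
      (le_self_pow₀ (by linarith [abs_nonneg (l : ℝ)]) (by omega))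
  have hsum0 : Summable (fourierCo Ψ) := by
    refine Summable.of_norm_bounded hsum fun l => ?_
    exact le_mul_of_one_le_right (norm_nonneg _) (hle l)
  set p : ℤ → ℂ := fun l => fourierCo Ψ l * Complex.exp (l * τ * Complex.I) with hpdef
  have hpn : ∀ l, ‖p l‖ = ‖fourierCo Ψ l‖ := fun l => by
    rw [hpdef, norm_mul, norm_cexp_int_mul, mul_one]
  have hsum1 : Summable fun l : ℤ => (l : ℂ) * p l := by
    refine Summable.of_norm_bounded hsum fun l => ?_
    rw [norm_mul, hpn, Complex.norm_intCast, mul_comm]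
    exact mul_le_mul_of_nonneg_left (hle' l) (norm_nonneg _)
  obtain ⟨S, hS⟩ := hsum1
  have hre : S.re = 0 := by
    refine hasSum_neg_of_conj (fun l => ?_) hS
    simp only [hpdef, map_mul, ← Complex.exp_conj, hΨ, fourierCo_conj_neg]
    simp
  have hψτ := hasSum_fourierCo hdΨ.continuous hpΨ hsum0 τ
  obtain ⟨B, hB⟩ := abs_sinPowCoeff_le hβ
  obtain ⟨C, hC⟩ := exists_shift_bound (s := s) (L := L) hs0 hB (by
    have := sinPowCoeff_isBigO hβ hb
    rw [show -β - 1 = -s by ring, show -β - 3 = -s - 2 by rw [hs]; ring] at this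
    exact this)
  have hmain : ∀ k : ℕ, 1 ≤ k →
      ‖fourierCo (fun u => (sinPow β (u - τ) : ℂ) * Ψ u) k - Complex.exp (-(k * τ * Complex.I)) *
        (((L * (k : ℝ) ^ (-s) * ψ τ : ℝ) : ℂ) + ((L * s * (k : ℝ) ^ (-s - 1) : ℝ) : ℂ) * S)‖
      ≤ (∑' l : ℤ, ‖fourierCo Ψ l‖ * (1 + |(l : ℝ)|) ^ q) * (C * (k : ℝ) ^ (-s - 2)) := by
    intro k hk
    have h1 := hasSum_fourierCo_sinPow_mul hβ τ hdΨ.continuous hpΨ hsum0 (k : ℤ)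
    have h2 := hψτ.mul_left
      (Complex.exp (-(k * τ * Complex.I)) * ((L * (k : ℝ) ^ (-s) : ℝ) : ℂ))
    have h3 := hS.mul_left
      (Complex.exp (-(k * τ * Complex.I)) * ((L * s * (k : ℝ) ^ (-s - 1) : ℝ) : ℂ))
    have h4 := (h1.sub h2).sub h3
    have e : fourierCo (fun u => (sinPow β (u - τ) : ℂ) * Ψ u) k
        - Complex.exp (-(k * τ * Complex.I)) * (((L * (k : ℝ) ^ (-s) * ψ τ : ℝ) : ℂ)
          + ((L * s * (k : ℝ) ^ (-s - 1) : ℝ) : ℂ) * S)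
        = fourierCo (fun u => (sinPow β (u - τ) : ℂ) * Ψ u) k
        - Complex.exp (-(k * τ * Complex.I)) * ((L * (k : ℝ) ^ (-s) : ℝ) : ℂ) * Ψ τ
        - Complex.exp (-(k * τ * Complex.I)) * ((L * s * (k : ℝ) ^ (-s - 1) : ℝ) : ℂ) * S := by
      simp only [hΨ]
      push_cast
      ring
    rw [e]
    refine h4.norm_le_of_bounded (hsum.hasSum.mul_right (C * (k : ℝ) ^ (-s - 2))) fun l => ?_
    have e2 : Complex.exp (-((k : ℤ) * τ * Complex.I)) *
          (fourierCo Ψ l * Complex.exp (l * τ * Complex.I) * sinPowCoeff β (k - l))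
        - Complex.exp (-(k * τ * Complex.I)) * ((L * (k : ℝ) ^ (-s) : ℝ) : ℂ) *
          (fourierCo Ψ l * Complex.exp (l * τ * Complex.I))
        - Complex.exp (-(k * τ * Complex.I)) * ((L * s * (k : ℝ) ^ (-s - 1) : ℝ) : ℂ) * (l * p l)
        = Complex.exp (-((k : ℤ) * τ * Complex.I)) * (p l * ((sinPowCoeff β (k - l)
          - L * (k : ℝ) ^ (-s) - L * s * l * (k : ℝ) ^ (-s - 1) : ℝ) : ℂ)) := by
      simp only [hpdef]
      push_cast
      ring
    rw [e2, norm_mul, norm_cexp_neg_int_mul, one_mul, norm_mul, hpn, Complex.norm_real,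
      norm_eq_abs, mul_assoc ‖fourierCo Ψ l‖]
    refine mul_le_mul_of_nonneg_left ?_ (norm_nonneg _)
    refine (hC k hk l).trans (le_of_eq ?_)
    ring
  -- S is i times a real number, so the real part of e^(-ikτ) S is (Im S) sin(kτ).
  refine ⟨L * s * S.im, IsBigO.of_bound
    ((∑' l : ℤ, ‖fourierCo Ψ l‖ * (1 + |(l : ℝ)|) ^ q) * C) ?_⟩
  filter_upwards [eventually_ge_atTop 1] with k hk
  rw [norm_of_nonneg (by positivity : (0 : ℝ) ≤ (k : ℝ) ^ (-s - 2))]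
  refine le_trans ?_ ((hmain k hk).trans_eq (mul_assoc _ _ _).symm)
  refine le_trans (le_of_eq ?_) (Complex.abs_re_le_norm _)
  rw [norm_eq_abs]
  congr 1
  have h5 := fourierCo_ofReal_re (h := fun u => sinPow β (u - τ) * ψ u)
    (((continuous_sinPow hβ).comp (by fun_prop)).mul hd.continuous) k
  have e3 : (fun u => (sinPow β (u - τ) : ℂ) * Ψ u)
      = fun u => ((sinPow β (u - τ) * ψ u : ℝ) : ℂ) := by
    funext u; simp [hΨ]
  have e4 : Complex.exp (-(k * τ * Complex.I)) = ((cos (k * τ) : ℝ) : ℂ)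
      - ((sin (k * τ) : ℝ) : ℂ) * Complex.I := by
    rw [show (-(k * τ * Complex.I) : ℂ) = (-(k * τ)) * Complex.I by ring, Complex.exp_mul_I,
      Complex.cos_neg, Complex.sin_neg]
    push_cast; ring
  have e5 : S = ((S.im : ℝ) : ℂ) * Complex.I := by
    apply Complex.ext <;> simp [hre]
  rw [Complex.sub_re, e3, h5, e4, e5]
  simp only [Complex.mul_re, Complex.mul_im, Complex.add_re, Complex.add_im, Complex.sub_re,
    Complex.sub_im, Complex.ofReal_re, Complex.ofReal_im, Complex.I_re, Complex.I_im,
    Int.cast_natCast]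
  ring

/-! ### Tails of oscillating and monotone power series -/

/-- `HasTail s d M` says that the tails `∑_{k > n} d k` are `M n + O(n ^ (-s - 1))`; it is witnessed
by an approximate antidifference of `d` that tends to zero. -/
def HasTail (s : ℝ) (d M : ℕ → ℝ) : Prop :=
  ∃ E : ℕ → ℝ, Tendsto E atTop (𝓝 0) ∧
    ((fun n => E n - E (n + 1) - d (n + 1)) =O[atTop] fun n : ℕ => (n : ℝ) ^ (-s - 2)) ∧
    ((fun n => E n - M n) =O[atTop] fun n : ℕ => (n : ℝ) ^ (-s - 1))

theorem HasTail.add {s : ℝ} {d₁ d₂ M₁ M₂ : ℕ → ℝ} (h₁ : HasTail s d₁ M₁) (h₂ : HasTail s d₂ M₂) :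
    HasTail s (fun n => d₁ n + d₂ n) fun n => M₁ n + M₂ n := by
  obtain ⟨E₁, t₁, i₁, m₁⟩ := h₁
  obtain ⟨E₂, t₂, i₂, m₂⟩ := h₂
  refine ⟨fun n => E₁ n + E₂ n, by simpa using t₁.add t₂, ?_, ?_⟩
  · exact (i₁.add i₂).congr_left fun n => by ring
  · exact (m₁.add m₂).congr_left fun n => by ring

theorem HasTail.const_mul {s : ℝ} {d M : ℕ → ℝ} (h : HasTail s d M) (c : ℝ) :
    HasTail s (fun n => c * d n) fun n => c * M n := by
  obtain ⟨E, t, i, m⟩ := h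
  refine ⟨fun n => c * E n, by simpa using t.const_mul c, ?_, ?_⟩
  · exact (i.const_mul_left c).congr_left fun n => by ring
  · exact (m.const_mul_left c).congr_left fun n => by ring

theorem hasTail_zero_of_isBigO {s : ℝ} (hs : 0 < s) {d : ℕ → ℝ}
    (hd : d =O[atTop] fun n : ℕ => (n : ℝ) ^ (-s - 2)) : HasTail s d fun _ => 0 := by
  refine ⟨fun _ => 0, tendsto_const_nhds, ?_, by simpa using isBigO_zero _ _⟩
  have h := hd.comp_tendsto (tendsto_add_atTop_nat 1)
  simp only [sub_zero, zero_sub]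
  refine IsBigO.neg_left (h.trans (IsBigO.of_bound 1 ?_))
  filter_upwards [eventually_ge_atTop 1] with n hn
  have hn0 : (0 : ℝ) < n := by exact_mod_cast hn
  simp only [Function.comp_apply]
  rw [norm_of_nonneg (by positivity), norm_of_nonneg (by positivity), one_mul]
  exact rpow_le_rpow_of_nonpos hn0 (by push_cast; linarith) (by linarith)

/-- The difference between the true tail and the approximate antidifference is null with increments
O(n^(-s-2)), hence O(n^(-s-1)). -/
theorem HasTail.isBigO {s : ℝ} (hs : 0 < s) {d M R : ℕ → ℝ} (h : HasTail s d M)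
    (hR : Tendsto R atTop (𝓝 0)) (hd : ∀ n, R n - R (n + 1) = d (n + 1)) :
    (fun n => R n - M n) =O[atTop] fun n : ℕ => (n : ℝ) ^ (-s - 1) := by
  obtain ⟨E, t, i, m⟩ := h
  have h1 : (fun n => R n - E n) =O[atTop] fun n : ℕ => (n : ℝ) ^ (-(s + 1)) := by
    refine isBigO_of_tendsto_zero_of_sub (by linarith) (by simpa using hR.sub t) ?_
    rw [show -(s + 1) - 1 = -s - 2 by ring]
    exact i.neg_left.congr_left fun n => by rw [← hd n]; ring
  rw [show -(s + 1) = -s - 1 by ring] at h1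
  exact (h1.add m).congr_left fun n => by ring

theorem succ_rpow_neg_sub_add_isBigO {s : ℝ} (hs : 0 < s) :
    (fun n : ℕ => ((n + 1 : ℕ) : ℝ) ^ (-s) - (n : ℝ) ^ (-s) + s * (n : ℝ) ^ (-s - 1))
      =O[atTop] fun n : ℕ => (n : ℝ) ^ (-s - 2) := by
  obtain ⟨C, hC, hb⟩ := exists_abs_one_sub_rpow_neg_sub_le hs
  refine IsBigO.of_bound C ?_
  filter_upwards [eventually_ge_atTop 2] with n hn
  have hn2 : (2 : ℝ) ≤ n := by exact_mod_cast hn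
  have hn0 : (0 : ℝ) < n := by linarith
  have hx : (-(1 / n) : ℝ) ∈ Set.Icc (-(1 / 2) : ℝ) (1 / 2) := by
    have h1 : (1 / n : ℝ) ≤ 1 / 2 := one_div_le_one_div_of_le two_pos hn2
    have h2 : (0 : ℝ) ≤ 1 / n := by positivity
    constructor <;> linarith
  have h := hb _ hx
  have e1 : ((n + 1 : ℕ) : ℝ) ^ (-s) = (n : ℝ) ^ (-s) * (1 - -(1 / n)) ^ (-s) := by
    rw [← mul_rpow hn0.le (by rw [sub_neg_eq_add]; positivity)]
    congr 1; push_cast; field_simp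
    ring
  have e2 : (n : ℝ) ^ (-s - 1) = (n : ℝ) ^ (-s) / n := rpow_sub_one hn0.ne' _
  have e3 : (n : ℝ) ^ (-s - 2) = (n : ℝ) ^ (-s) / n ^ 2 := by
    rw [rpow_sub hn0]; norm_cast
  have e4 : ((n + 1 : ℕ) : ℝ) ^ (-s) - (n : ℝ) ^ (-s) + s * (n : ℝ) ^ (-s - 1)
      = (n : ℝ) ^ (-s) * ((1 - -(1 / n)) ^ (-s) - 1 - s * -(1 / n)) := by
    rw [e1, e2]; ring
  have hp : (0 : ℝ) < (n : ℝ) ^ (-s) := by positivity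
  rw [e4, norm_mul, norm_of_nonneg hp.le,
      norm_of_nonneg (by positivity : (0 : ℝ) ≤ (n : ℝ) ^ (-s - 2)), e3, norm_eq_abs]
  calc _ ≤ (n : ℝ) ^ (-s) * (C * |(-(1 / n) : ℝ)| ^ 2) := by gcongr
    _ = _ := by rw [sq_abs]; field_simp

theorem rpow_natCast_isBigO_of_le {p q : ℝ} (h : p ≤ q) :
    (fun n : ℕ => (n : ℝ) ^ p) =O[atTop] fun n : ℕ => (n : ℝ) ^ q := by
  refine IsBigO.of_bound 1 ?_
  filter_upwards [eventually_ge_atTop 1] with n hn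
  rw [norm_of_nonneg (by positivity), norm_of_nonneg (by positivity), one_mul]
  exact rpow_le_rpow_of_exponent_le (by exact_mod_cast hn) h

theorem succ_rpow_neg_sub_isBigO {s : ℝ} (hs : 0 < s) :
    (fun n : ℕ => ((n + 1 : ℕ) : ℝ) ^ (-s) - (n : ℝ) ^ (-s))
      =O[atTop] fun n : ℕ => (n : ℝ) ^ (-s - 1) := by
  have h1 := (succ_rpow_neg_sub_add_isBigO hs).trans
    (rpow_natCast_isBigO_of_le (by linarith : -s - 2 ≤ -s - 1))
  have h2 : (fun n : ℕ => s * (n : ℝ) ^ (-s - 1)) =O[atTop] fun n : ℕ => (n : ℝ) ^ (-s - 1) :=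
    (isBigO_refl _ _).const_mul_left s
  exact (h1.sub h2).congr_left fun n => by ring

theorem tendsto_rpow_neg_nat {p : ℝ} (hp : p < 0) :
    Tendsto (fun n : ℕ => (n : ℝ) ^ p) atTop (𝓝 0) := by
  have := (tendsto_rpow_neg_atTop (y := -p) (by linarith)).comp tendsto_natCast_atTop_atTop
  simpa [Function.comp_def] using this

theorem isBigO_bounded_mul {f : ℕ → ℂ} {c : ℝ} (hf : ∀ n, ‖f n‖ ≤ c) {e g : ℕ → ℝ}
    (he : e =O[atTop] g) : (fun n => f n * (e n : ℂ)) =O[atTop] g := by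
  have h1 : f =O[atTop] fun _ => (1 : ℝ) :=
    IsBigO.of_bound c (Eventually.of_forall fun n => by simpa using hf n)
  have h2 : (fun n => (e n : ℂ)) =O[atTop] g := by
    refine IsBigO.trans (IsBigO.of_bound 1 (.of_forall fun n => ?_)) he
    simp
  simpa using h1.mul h2

theorem isBigO_re {f : ℕ → ℂ} {g : ℕ → ℝ} (h : f =O[atTop] g) :
    (fun n => (f n).re) =O[atTop] g :=
  (IsBigO.of_bound 1 (.of_forall fun n => by
    simpa using Complex.abs_re_le_norm (f n))).trans h

/-- Summation by parts, carried to second order, for a unimodular z ≠ 1. -/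
theorem hasTail_re_pow {s : ℝ} (hs : 0 < s) {z : ℂ} (hz : ‖z‖ = 1) (hz1 : z ≠ 1) :
    HasTail s (fun n => (z ^ n).re * (n : ℝ) ^ (-s))
      fun n => (z ^ (n + 1) / (1 - z)).re * (n : ℝ) ^ (-s) := by
  have hz0 : 1 - z ≠ 0 := sub_ne_zero.2 hz1.symm
  -- The first term alone leaves a defect of order n^(-s-1); the second cancels it and is itself
  -- negligible in the tail.
  set F : ℕ → ℂ := fun n => z ^ (n + 1) / (1 - z) * ((n : ℝ) ^ (-s) : ℝ)
    - s * z ^ (n + 1) / (1 - z) ^ 2 * ((n : ℝ) ^ (-s - 1) : ℝ) with hF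
  have hb1 : ∀ n, ‖z ^ (n + 1) / (1 - z)‖ ≤ 1 / ‖1 - z‖ := fun n => by
    rw [norm_div, norm_pow, hz, one_pow]
  have hb2 : ∀ n, ‖s * z ^ (n + 1) / (1 - z) ^ 2‖ ≤ s / ‖1 - z‖ ^ 2 := fun n => by
    rw [norm_div, norm_mul, norm_pow, hz, one_pow, norm_pow, Complex.norm_real,
      norm_of_nonneg hs.le, mul_one]
  have hb3 : ∀ n, ‖s * z ^ (n + 2) / (1 - z) ^ 2‖ ≤ s / ‖1 - z‖ ^ 2 := fun n => hb2 (n + 1)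
  have hO1 := isBigO_bounded_mul hb1 (isBigO_refl (fun n : ℕ => (n : ℝ) ^ (-s)) atTop)
  have hO2 := isBigO_bounded_mul hb2 (isBigO_refl (fun n : ℕ => (n : ℝ) ^ (-s - 1)) atTop)
  refine ⟨fun n => (F n).re, ?_, ?_, ?_⟩
  · have h := hO1.sub (hO2.trans (rpow_natCast_isBigO_of_le (by linarith : -s - 1 ≤ -s)))
    have h2 := h.trans_tendsto (tendsto_rpow_neg_nat (by linarith : -s < 0))
    exact (Complex.continuous_re.tendsto 0).comp h2
  · have hA := isBigO_bounded_mul hb1 (succ_rpow_neg_sub_add_isBigO hs)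
    have hB := isBigO_bounded_mul hb3 (succ_rpow_neg_sub_isBigO (by linarith : 0 < s + 1))
    rw [show -(s + 1) - 1 = -s - 2 by ring] at hB
    refine (isBigO_re (hB.sub hA)).congr_left fun n => ?_
    have : F n - F (n + 1) - z ^ (n + 1) * (((n + 1 : ℕ) : ℝ) ^ (-s) : ℝ)
        = s * z ^ (n + 2) / (1 - z) ^ 2
            * ((((n + 1 : ℕ) : ℝ) ^ (-(s + 1)) - (n : ℝ) ^ (-(s + 1)) : ℝ) : ℂ)
          - z ^ (n + 1) / (1 - z) * ((((n + 1 : ℕ) : ℝ) ^ (-s) - (n : ℝ) ^ (-s)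
            + s * (n : ℝ) ^ (-s - 1) : ℝ) : ℂ) := by
      simp only [hF]
      rw [show -(s + 1) = -s - 1 by ring]
      generalize ((n + 1 : ℕ) : ℝ) ^ (-s) = a'
      generalize (n : ℝ) ^ (-s) = a
      generalize ((n + 1 : ℕ) : ℝ) ^ (-s - 1) = b'
      generalize (n : ℝ) ^ (-s - 1) = b
      push_cast
      field_simp
      ring
    rw [← this, Complex.sub_re, Complex.sub_re, Complex.re_mul_ofReal]
  · refine (isBigO_re hO2.neg_left).congr_left fun n => ?_
    simp only [hF]
    rw [Complex.sub_re, Complex.re_mul_ofReal (z ^ (n + 1) / (1 - z)), Complex.neg_re]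
    ring

/-- The additional power of n makes a single summation by parts enough; the factor -i turns
imaginary parts into real parts. -/
theorem hasTail_zero_im_pow {s : ℝ} (hs : 0 < s) {z : ℂ} (hz : ‖z‖ = 1) (hz1 : z ≠ 1) :
    HasTail s (fun n => (z ^ n).im * (n : ℝ) ^ (-s - 1)) fun _ => 0 := by
  have hz0 : 1 - z ≠ 0 := sub_ne_zero.2 hz1.symm
  set F : ℕ → ℂ := fun n => -Complex.I * z ^ (n + 1) / (1 - z) * ((n : ℝ) ^ (-s - 1) : ℝ) with hF
  have hb1 : ∀ n, ‖-Complex.I * z ^ (n + 1) / (1 - z)‖ ≤ 1 / ‖1 - z‖ := fun n => by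
    rw [norm_div, norm_mul, norm_neg, Complex.norm_I, one_mul, norm_pow, hz, one_pow]
  have hO1 := isBigO_bounded_mul hb1 (isBigO_refl (fun n : ℕ => (n : ℝ) ^ (-s - 1)) atTop)
  refine ⟨fun n => (F n).re, ?_, ?_, ?_⟩
  · have h2 := hO1.trans_tendsto (tendsto_rpow_neg_nat (by linarith : -s - 1 < 0))
    exact (Complex.continuous_re.tendsto 0).comp h2
  · have hA := isBigO_bounded_mul hb1 (succ_rpow_neg_sub_isBigO (by linarith : 0 < s + 1))
    rw [show -(s + 1) - 1 = -s - 2 by ring, show -(s + 1) = -s - 1 by ring] at hA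
    refine (isBigO_re hA.neg_left).congr_left fun n => ?_
    have : F n - F (n + 1) + Complex.I * (z ^ (n + 1) * (((n + 1 : ℕ) : ℝ) ^ (-s - 1) : ℝ))
        = -(-Complex.I * z ^ (n + 1) / (1 - z)
            * ((((n + 1 : ℕ) : ℝ) ^ (-s - 1) - (n : ℝ) ^ (-s - 1) : ℝ) : ℂ)) := by
      simp only [hF]
      generalize ((n + 1 : ℕ) : ℝ) ^ (-s - 1) = b'
      generalize (n : ℝ) ^ (-s - 1) = b
      push_cast
      field_simp
      ring
    rw [← this, Complex.add_re, Complex.sub_re, Complex.I_mul_re, Complex.im_mul_ofReal]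
    ring
  · exact (isBigO_re hO1).congr_left fun n => by simp only [hF, sub_zero]

/-- This is the error of the trapezoidal rule for ∫ t^(-s) dt over [1, 1 + x]. -/
theorem exists_abs_trapezoid_le {s : ℝ} (hs : 1 < s) : ∃ C : ℝ, 0 ≤ C ∧
    ∀ x ∈ Set.Icc (0 : ℝ) 1,
      |(1 - (1 + x) ^ (1 - s)) / (s - 1) - 1 / 2 * x - 1 / 2 * x * (1 + x) ^ (-s)|
        ≤ C * x ^ 3 := by
  obtain ⟨C, hC, hCb⟩ := exists_abs_one_add_rpow_le (-s - 1 - 1)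
  have hs1 : s - 1 ≠ 0 := by linarith
  refine ⟨|s / 2 * (-s - 1)| * C, by positivity, ?_⟩
  refine abs_le_of_abs_deriv_le_pow (h' := fun x => 1 / 2 * (1 + x) ^ (-s) - 1 / 2
    + s / 2 * x * (1 + x) ^ (-s - 1)) (by positivity) (by simp) ?_ ?_
  · intro x hx
    have h1 := ((hasDerivAt_one_add_rpow (1 - s) hx.1).const_sub 1).div_const (s - 1)
    have h2 := ((hasDerivAt_id x).const_mul (1 / 2 : ℝ)).mul (hasDerivAt_one_add_rpow (-s) hx.1)
    have h3 := (h1.sub ((hasDerivAt_id x).const_mul (1 / 2 : ℝ))).sub h2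
    refine h3.congr_deriv ?_
    rw [show 1 - s - 1 = -s by ring]
    simp only [id]
    field_simp
    ring
  · refine abs_le_of_abs_deriv_le_pow (n := 1)
      (h' := fun x => s / 2 * x * ((-s - 1) * (1 + x) ^ (-s - 1 - 1)))
      (by positivity) (by simp) ?_ ?_
    · intro x hx
      have h1 := ((hasDerivAt_one_add_rpow (-s) hx.1).const_mul (1 / 2 : ℝ)).sub_const (1 / 2 : ℝ)
      have h2 := ((hasDerivAt_id x).const_mul (s / 2)).mul (hasDerivAt_one_add_rpow (-s - 1) hx.1)
      refine (h1.add h2).congr_deriv ?_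
      simp only [id]
      ring
    · intro x hx
      have : s / 2 * x * ((-s - 1) * (1 + x) ^ (-s - 1 - 1))
          = (s / 2 * (-s - 1)) * (1 + x) ^ (-s - 1 - 1) * x := by ring
      rw [this, abs_mul, abs_mul, abs_of_nonneg hx.1, pow_one]
      have := hCb x hx
      have := hx.1
      gcongr

/-- The resonant case: the two Euler–Maclaurin terms serve as the antidifference, and their defect
is the trapezoidal error scaled to x = 1/n. -/
theorem hasTail_rpow {s : ℝ} (hs : 1 < s) :
    HasTail s (fun n => (n : ℝ) ^ (-s))
      fun n => (n : ℝ) ^ (1 - s) / (s - 1) - (n : ℝ) ^ (-s) / 2 := by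
  have hs1 : s - 1 ≠ 0 := by linarith
  refine ⟨fun n => (n : ℝ) ^ (1 - s) / (s - 1) - (n : ℝ) ^ (-s) / 2, ?_, ?_, by
    simp only [sub_self]; exact isBigO_zero _ _⟩
  · have h1 := (tendsto_rpow_neg_nat (by linarith : 1 - s < 0)).div_const (s - 1)
    have h2 := (tendsto_rpow_neg_nat (by linarith : -s < 0)).div_const 2
    simpa using h1.sub h2
  · obtain ⟨C, hC, hb⟩ := exists_abs_trapezoid_le hs
    refine IsBigO.of_bound C ?_
    filter_upwards [eventually_ge_atTop 1] with n hn
    have hn1 : (1 : ℝ) ≤ n := by exact_mod_cast hn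
    have hn0 : (0 : ℝ) < n := by linarith
    have hx : (1 / n : ℝ) ∈ Set.Icc (0 : ℝ) 1 :=
      ⟨by positivity, by rw [div_le_one hn0]; exact hn1⟩
    have h := hb _ hx
    have e1 : ∀ p : ℝ, ((n + 1 : ℕ) : ℝ) ^ p = (n : ℝ) ^ p * (1 + 1 / n) ^ p := fun p => by
      rw [← mul_rpow hn0.le (by positivity)]
      congr 1; push_cast; field_simp
    have e2 : (n : ℝ) ^ (-s) = (n : ℝ) ^ (1 - s) / n := by
      rw [← rpow_sub_one hn0.ne']; congr 1; ring
    have e3 : (n : ℝ) ^ (-s - 2) = (n : ℝ) ^ (1 - s) / n ^ 3 := by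
      rw [← rpow_natCast, ← rpow_sub hn0]; congr 1; push_cast; ring
    have hp : (0 : ℝ) < (n : ℝ) ^ (1 - s) := by positivity
    have e4 : (n : ℝ) ^ (1 - s) / (s - 1) - (n : ℝ) ^ (-s) / 2
        - (((n + 1 : ℕ) : ℝ) ^ (1 - s) / (s - 1) - ((n + 1 : ℕ) : ℝ) ^ (-s) / 2)
        - ((n + 1 : ℕ) : ℝ) ^ (-s)
        = (n : ℝ) ^ (1 - s) * ((1 - (1 + 1 / n) ^ (1 - s)) / (s - 1) - 1 / 2 * (1 / n)
          - 1 / 2 * (1 / n) * (1 + 1 / n) ^ (-s)) := by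
      rw [e1, e1, e2]; ring
    rw [e4, norm_mul, norm_of_nonneg hp.le,
      norm_of_nonneg (by positivity : (0 : ℝ) ≤ (n : ℝ) ^ (-s - 2)), e3, norm_eq_abs]
    calc _ ≤ (n : ℝ) ^ (1 - s) * (C * (1 / n) ^ 3) := by gcongr
      _ = _ := by field_simp

theorem cexp_mul_I_ne_one {ω : ℝ} (hω : sin (ω / 2) ≠ 0) : Complex.exp (ω * Complex.I) ≠ 1 := by
  intro h
  rw [Complex.exp_eq_one_iff] at h
  obtain ⟨n, hn⟩ := h
  refine hω ?_
  have h2 : (ω : ℂ) = ((n * (2 * π) : ℝ) : ℂ) := by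
    have := mul_right_cancel₀ Complex.I_ne_zero
      (show (ω : ℂ) * Complex.I = (n * (2 * π)) * Complex.I by rw [hn]; ring)
    rw [this]; push_cast; ring
  have h3 : ω = n * (2 * π) := by exact_mod_cast h2
  rw [h3, sin_eq_zero_iff]
  exact ⟨n, by ring⟩

theorem cexp_mul_I_pow (ω : ℝ) (n : ℕ) :
    Complex.exp (ω * Complex.I) ^ n = Complex.exp (((n * ω : ℝ) : ℂ) * Complex.I) := by
  rw [← Complex.exp_nat_mul]; congr 1; push_cast; ring

theorem chebU_two_mul_cos {φ : ℝ} (hφ : sin φ ≠ 0) (n : ℕ) :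
    chebU (2 * n) (cos φ) = sin ((2 * n + 1) * φ) / sin φ := by
  rw [eq_div_iff hφ, chebU, Polynomial.Chebyshev.U_real_cos]
  push_cast; rfl

/-- Since 1 - e^(iω) = -2i sin(ω/2) e^(iω/2), the quotient has real part -sin((2n+1)ω/2) / (2
sin(ω/2)), a value of U_{2n}. -/
theorem re_cexp_pow_div {ω : ℝ} (hω : sin (ω / 2) ≠ 0) (n : ℕ) :
    (Complex.exp (ω * Complex.I) ^ (n + 1) / (1 - Complex.exp (ω * Complex.I))).re
      = -(chebU (2 * n) (cos (ω / 2)) / 2) := by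
  have h1 : 1 - Complex.exp (ω * Complex.I) ≠ 0 := sub_ne_zero.2 (cexp_mul_I_ne_one hω).symm
  set φ := ω / 2 with hφ
  have hφ0 : (sin φ : ℂ) ≠ 0 := by exact_mod_cast hω
  have h2 : 1 - Complex.exp (ω * Complex.I)
      = -2 * Complex.I * sin φ * Complex.exp (φ * Complex.I) := by
    have : (ω : ℂ) * Complex.I = φ * Complex.I + φ * Complex.I := by
      rw [hφ]; push_cast; ring
    rw [this, Complex.exp_add, Complex.exp_mul_I, ← Complex.ofReal_cos, ← Complex.ofReal_sin]
    have hI := Complex.I_sq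
    have hsc : ((cos φ : ℝ) : ℂ) ^ 2 + ((sin φ : ℝ) : ℂ) ^ 2 = 1 := by
      exact_mod_cast cos_sq_add_sin_sq φ
    linear_combination (-1 : ℂ) * hsc + ((sin φ : ℝ) : ℂ) ^ 2 * hI
  have h3 : Complex.exp (ω * Complex.I) ^ (n + 1)
      = Complex.exp ((((2 * n + 1) * φ : ℝ) : ℂ) * Complex.I) * Complex.exp (φ * Complex.I) := by
    rw [← Complex.exp_nat_mul, ← Complex.exp_add]
    congr 1
    rw [hφ]; push_cast; ring
  have h4 : Complex.exp (ω * Complex.I) ^ (n + 1) / (1 - Complex.exp (ω * Complex.I))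
      = Complex.I * Complex.exp ((((2 * n + 1) * φ : ℝ) : ℂ) * Complex.I)
        * ((1 / (2 * sin φ) : ℝ) : ℂ) := by
    rw [h2, h3]
    have := Complex.exp_ne_zero (φ * Complex.I)
    have hI := Complex.I_ne_zero
    have hI2 := Complex.I_sq
    push_cast
    rw [← Complex.ofReal_sin]
    field_simp
    linear_combination (-1 : ℂ) * hI2
  rw [h4, Complex.re_mul_ofReal, Complex.I_mul_re, Complex.exp_ofReal_mul_I_im,
    chebU_two_mul_cos hω]
  field_simp

theorem hasTail_cos {s : ℝ} (hs : 0 < s) {ω : ℝ} (hω : sin (ω / 2) ≠ 0) :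
    HasTail s (fun n => cos (n * ω) * (n : ℝ) ^ (-s))
      fun n => -(chebU (2 * n) (cos (ω / 2)) / 2) * (n : ℝ) ^ (-s) := by
  have h := hasTail_re_pow hs (Complex.norm_exp_ofReal_mul_I ω) (cexp_mul_I_ne_one hω)
  simp only [re_cexp_pow_div hω] at h
  simp only [cexp_mul_I_pow, Complex.exp_ofReal_mul_I_re] at h
  exact h

/-- At a resonant frequency every sine vanishes, and otherwise summation by parts applies; so ω is
arbitrary. -/
theorem hasTail_sin {s : ℝ} (hs : 0 < s) (ω : ℝ) :
    HasTail s (fun n => sin (n * ω) * (n : ℝ) ^ (-s - 1)) fun _ => 0 := by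
  by_cases hω : sin (ω / 2) = 0
  · have h0 : ∀ n : ℕ, sin (n * ω) = 0 := fun n => by
      obtain ⟨m, hm⟩ := sin_eq_zero_iff.1 hω
      rw [sin_eq_zero_iff]
      exact ⟨2 * n * m, by push_cast; linear_combination (2 * n : ℝ) * hm⟩
    simp only [h0, zero_mul]
    exact hasTail_zero_of_isBigO hs (isBigO_zero _ _)
  · have h := hasTail_zero_im_pow hs (Complex.norm_exp_ofReal_mul_I ω) (cexp_mul_I_ne_one hω)
    simp only [cexp_mul_I_pow, Complex.exp_ofReal_mul_I_im] at h
    exact h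

/-! ### From Chebyshev series to Fourier series -/

theorem chebT_cos (k : ℕ) (θ : ℝ) : chebT k (cos θ) = cos (k * θ) := by
  rw [chebT, Polynomial.Chebyshev.T_real_cos]; push_cast; rfl

theorem chebCoeff_eq_integral_cos (f : ℝ → ℝ) (k : ℕ) :
    chebCoeff f k = 2 / π * ∫ θ in (0 : ℝ)..π, f (cos θ) * cos (k * θ) := by
  have h1 := Polynomial.Chebyshev.integral_measureT (fun x => f x * chebT k x)
  rw [Polynomial.Chebyshev.integral_measureT_eq_integral_cos] at h1
  simp only [chebT_cos] at h1
  rw [h1, chebCoeff]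
  simp only [div_eq_mul_inv, sqrt_inv]

theorem integral_symm_eq {h : ℝ → ℝ} (hc : Continuous h) :
    ∫ u in -π..π, h u = ∫ u in (0 : ℝ)..π, (h u + h (-u)) := by
  have hi : ∀ a b, IntervalIntegrable h volume a b := fun a b => hc.intervalIntegrable a b
  rw [intervalIntegral.integral_add (hi 0 π) (Continuous.intervalIntegrable (by fun_prop) _ _),
    intervalIntegral.integral_comp_neg, neg_zero,
    ← intervalIntegral.integral_add_adjacent_intervals (hi (-π) 0) (hi 0 π), add_comm]

/-- Folding [-π, π] onto [0, π] lets P carry only one of the two mirror singularities ±τ. -/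
theorem chebCoeff_eq_of_eq_add {f P : ℝ → ℝ} (hP : Continuous P)
    (hf : ∀ θ, f (cos θ) = P θ + P (-θ)) (k : ℕ) :
    chebCoeff f k = 4 * (1 / (2 * π) * ∫ u in -π..π, P u * cos (k * u)) := by
  rw [chebCoeff_eq_integral_cos, integral_symm_eq (h := fun u => P u * cos (k * u)) (by fun_prop)]
  have : ∀ θ : ℝ, f (cos θ) * cos (k * θ)
      = P θ * cos (k * θ) + P (-θ) * cos (k * -θ) := fun θ => by
    rw [hf, mul_neg, cos_neg]; ring
  simp only [this]
  ring

theorem chebProj_succ (f : ℝ → ℝ) (n : ℕ) (x : ℝ) :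
    chebProj f (n + 1) x = chebProj f n x + chebCoeff f (n + 1) * chebT (n + 1) x := by
  rw [chebProj, chebProj, Finset.sum_Icc_succ_top (by omega)]
  ring

theorem chebProj_cos (f : ℝ → ℝ) (n : ℕ) (θ : ℝ) :
    chebProj f n (cos θ)
      = ∑ k ∈ Finset.range (n + 1), chebCoeff f k * cos (k * θ) - chebCoeff f 0 / 2 := by
  induction n with
  | zero => simp [chebProj, chebT]; ring
  | succ n ih => rw [chebProj_succ, ih, Finset.sum_range_succ _ (n + 1), chebT_cos]; ring

/-- The Chebyshev projections of a continuous function with summable coefficients converge. -/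
theorem tendsto_sub_chebProj {f : ℝ → ℝ} (hf : ContinuousOn f (Set.Icc (-1) 1))
    (hs : Summable (chebCoeff f)) (θ : ℝ) :
    Tendsto (fun n => f (cos θ) - chebProj f n (cos θ)) atTop (𝓝 0) := by
  have hF : Continuous fun θ => f (cos θ) :=
    hf.comp_continuous continuous_cos fun θ => ⟨neg_one_le_cos θ, cos_le_one θ⟩
  have hco : ∀ l : ℤ, fourierCo (fun θ => (f (cos θ) : ℂ)) l
      = ((chebCoeff f l.natAbs / 2 : ℝ) : ℂ) := by
    intro l
    have h1 : (1 / (2 * π) : ℂ) = ((1 / (2 * π) : ℝ) : ℂ) := by push_cast; rfl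
    rw [fourierCo, integral_even_mul_cexp hF (fun u => by rw [cos_neg]), h1,
      ← Complex.ofReal_mul]
    congr 1
    have h2 : ∀ u : ℝ, cos (l * u) = cos ((l.natAbs : ℝ) * u) := fun u => by
      rw [← cos_abs, abs_mul, ← cos_abs (_ * u), abs_mul, Nat.abs_cast, Nat.cast_natAbs]
      push_cast; rfl
    simp only [h2]
    rw [chebCoeff_eq_of_eq_add (P := fun θ => f (cos θ) / 2) (hF.div_const 2)
      (fun θ => by rw [cos_neg]; ring)]
    simp only [div_mul_eq_mul_div, intervalIntegral.integral_div]
    ring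
  have hsum : Summable (fourierCo fun θ => (f (cos θ) : ℂ)) := by
    have h1 : Summable fun k : ℕ => ((chebCoeff f k / 2 : ℝ) : ℂ) :=
      Complex.summable_ofReal.2 (hs.div_const 2)
    refine Summable.of_nat_of_neg ?_ ?_
    · simpa only [hco, Int.natAbs_natCast] using h1
    · simpa only [hco, Int.natAbs_neg, Int.natAbs_natCast] using h1
  have hper : Function.Periodic (fun θ => (f (cos θ) : ℂ)) (2 * π) := fun θ => by
    simp only [cos_add_two_pi]
  have h := (hasSum_fourierCo (h := fun θ => (f (cos θ) : ℂ))
    (Complex.continuous_ofReal.comp hF) hper hsum θ).nat_add_neg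
  have h3 : ∀ k : ℕ, fourierCo (fun θ => (f (cos θ) : ℂ)) k * Complex.exp ((k : ℤ) * θ * Complex.I)
      + fourierCo (fun θ => (f (cos θ) : ℂ)) (-k) * Complex.exp ((-k : ℤ) * θ * Complex.I)
      = ((chebCoeff f k * cos (k * θ) : ℝ) : ℂ) := by
    intro k
    simp only [hco, Int.natAbs_neg, Int.natAbs_natCast]
    push_cast
    rw [Complex.cos, show -(k : ℂ) * θ * Complex.I = -(k * θ) * Complex.I by ring]
    ring
  -- Pairing l with -l counts l = 0 twice, which accounts for the extra a_0/2 in the sum.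
  have h4 : HasSum (fun k : ℕ => ((chebCoeff f k * cos (k * θ) : ℝ) : ℂ))
      ((f (cos θ) + chebCoeff f 0 / 2 : ℝ) : ℂ) := by
    convert! h using 1
    · funext k; exact (h3 k).symm
    · simp [hco]
  have h5 := (Complex.hasSum_ofReal.1 h4).tendsto_sum_nat
  have h6 := ((tendsto_add_atTop_iff_nat 1).2 h5).const_sub (f (cos θ) + chebCoeff f 0 / 2)
  rw [sub_self] at h6
  refine h6.congr fun n => ?_
  rw [chebProj_cos]; ring

/-! ### From coefficient expansions to projection errors -/

/-- Two-term expansion of Chebyshev coefficients with a singularity at `cos τ`. -/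
def CoeffExpansion (f : ℝ → ℝ) (s τ A σ : ℝ) : Prop :=
  (fun k : ℕ => chebCoeff f k - (A * cos (k * τ) * (k : ℝ) ^ (-s)
    + σ * sin (k * τ) * (k : ℝ) ^ (-s - 1))) =O[atTop] fun k : ℕ => (k : ℝ) ^ (-s - 2)

theorem isBigO_mul_of_abs_le_one {b e g : ℕ → ℝ} (hb : ∀ n, |b n| ≤ 1) (he : e =O[atTop] g) :
    (fun n => e n * b n) =O[atTop] g :=
  (IsBigO.of_bound 1 (Eventually.of_forall fun n => by
    rw [norm_mul, one_mul]
    exact mul_le_of_le_one_right (norm_nonneg _) (hb n))).trans he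

theorem CoeffExpansion.summable {f : ℝ → ℝ} {s τ A σ : ℝ} (h : CoeffExpansion f s τ A σ)
    (hs : 1 < s) : Summable (chebCoeff f) := by
  refine summable_of_isBigO_nat (Real.summable_nat_rpow.2 (by linarith : -s < -1)) ?_
  have h1 : (fun k : ℕ => A * ((k : ℝ) ^ (-s) * cos (k * τ))) =O[atTop]
      fun k : ℕ => (k : ℝ) ^ (-s) :=
    (isBigO_mul_of_abs_le_one (fun k => abs_cos_le_one _) (isBigO_refl _ _)).const_mul_left A
  have h2 : (fun k : ℕ => σ * ((k : ℝ) ^ (-s - 1) * sin (k * τ))) =O[atTop]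
      fun k : ℕ => (k : ℝ) ^ (-s) :=
    (isBigO_mul_of_abs_le_one (fun k => abs_sin_le_one _)
      (rpow_natCast_isBigO_of_le (by linarith))).const_mul_left σ
  exact (((IsBigO.trans h (rpow_natCast_isBigO_of_le (by linarith))).add h1).add h2).congr_left
    fun k => by ring

/-- Product-to-sum formulas give the frequencies θ ± τ; the σ part becomes sines, whose tails are
negligible at this order. -/
theorem CoeffExpansion.hasTail {f : ℝ → ℝ} {s τ A σ : ℝ} (h : CoeffExpansion f s τ A σ)
    (hs : 1 < s) {θ : ℝ} {M₁ M₂ : ℕ → ℝ}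
    (h₁ : HasTail s (fun n => cos (n * (θ + τ)) * (n : ℝ) ^ (-s)) M₁)
    (h₂ : HasTail s (fun n => cos (n * (θ - τ)) * (n : ℝ) ^ (-s)) M₂) :
    HasTail s (fun n => chebCoeff f n * cos (n * θ)) fun n => A / 2 * (M₁ n + M₂ n) := by
  have hs0 : 0 < s := by linarith
  have hE := hasTail_zero_of_isBigO hs0
    (isBigO_mul_of_abs_le_one (b := fun n : ℕ => cos (n * θ)) (fun n => abs_cos_le_one _) h)
  have hall := (((h₁.add h₂).const_mul (A / 2)).add
    (((hasTail_sin hs0 (θ + τ)).add ((hasTail_sin hs0 (θ - τ)).const_mul (-1))).const_mul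
      (σ / 2))).add hE
  convert hall using 1
  · funext n
    rw [mul_add (n : ℝ), mul_sub (n : ℝ), cos_add, cos_sub, sin_add, sin_sub]
    ring
  · funext n; ring

theorem CoeffExpansion.isBigO {f : ℝ → ℝ} {s τ A σ : ℝ} (h : CoeffExpansion f s τ A σ)
    (hf : ContinuousOn f (Set.Icc (-1) 1)) (hs : 1 < s) {θ : ℝ} {M₁ M₂ : ℕ → ℝ}
    (h₁ : HasTail s (fun n => cos (n * (θ + τ)) * (n : ℝ) ^ (-s)) M₁)
    (h₂ : HasTail s (fun n => cos (n * (θ - τ)) * (n : ℝ) ^ (-s)) M₂) :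
    (fun n => f (cos θ) - chebProj f n (cos θ) - A / 2 * (M₁ n + M₂ n))
      =O[atTop] fun n : ℕ => (n : ℝ) ^ (-s - 1) :=
  (h.hasTail hs h₁ h₂).isBigO (by linarith) (tendsto_sub_chebProj hf (h.summable hs) θ) fun n => by
    rw [chebProj_succ, chebT_cos]; ring

theorem coeffExpansion_of_eq_add {f ψ : ℝ → ℝ} {β : ℝ} (hβ : 0 < β)
    (hb : ∀ j : ℤ, β ≠ 2 * (j : ℝ)) (τ : ℝ) (hd : ContDiff ℝ (⌈β + 1⌉₊ + 5 : ℕ) ψ)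
    (hp : Function.Periodic ψ (2 * π))
    (hf : ∀ θ, f (cos θ) = sinPow β (θ - τ) * ψ θ + sinPow β (-θ - τ) * ψ (-θ)) :
    ∃ σ, CoeffExpansion f (β + 1) τ (4 * (sinPowConst β * ψ τ)) σ := by
  obtain ⟨σ, hσ⟩ := exists_fourierCo_expansion hβ hb τ hd hp
  refine ⟨4 * σ, (hσ.const_mul_left 4).congr_left fun k => ?_⟩
  have hP : Continuous fun θ => sinPow β (θ - τ) * ψ θ :=
    ((continuous_sinPow hβ).comp (by fun_prop)).mul hd.continuous
  rw [chebCoeff_eq_of_eq_add hP hf]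
  ring

/-! ### Isolating the singularity of the model function -/

theorem abs_cos_sub_cos (θ τ : ℝ) :
    |cos θ - cos τ| = |2 * sin ((θ - τ) / 2)| * |2 * sin ((θ + τ) / 2)| / 2 := by
  rw [cos_sub_cos, abs_mul, abs_mul, abs_mul, abs_mul, abs_neg, abs_two]
  ring

theorem abs_cos_sub_cos_rpow (α θ τ : ℝ) :
    |cos θ - cos τ| ^ α = (2 : ℝ) ^ (-α) * (sinPow α (θ - τ) * sinPow α (θ + τ)) := by
  rw [abs_cos_sub_cos, div_rpow (by positivity) zero_le_two, mul_rpow (abs_nonneg _) (abs_nonneg _),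
    rpow_neg zero_le_two, sinPow, sinPow]
  ring

theorem continuousOn_modelFun {α ξ : ℝ} (hα : 0 < α) {g : ℝ → ℝ}
    (hg : ContinuousOn g (Set.Icc (-1) 1)) : ContinuousOn (modelFun α ξ g) (Set.Icc (-1) 1) := by
  refine ContinuousOn.mul (Continuous.continuousOn ?_) hg
  exact Continuous.rpow_const (by fun_prop) fun _ => Or.inr hα.le

theorem contDiff_comp_cos {m : ℕ} {g : ℝ → ℝ} (hg : ContDiffOn ℝ m g (Set.Icc (-1) 1)) :
    ContDiff ℝ m fun θ => g (cos θ) :=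
  hg.comp_contDiff contDiff_cos fun θ => ⟨neg_one_le_cos θ, cos_le_one θ⟩

theorem smoothTransition_add_one_sub (x : ℝ) :
    Real.smoothTransition x + Real.smoothTransition (1 - x) = 1 := by
  have h := (Real.smoothTransition.pos_denom x).ne'
  rw [Real.smoothTransition, Real.smoothTransition, sub_sub_cancel,
    add_comm (expNegInvGlue (1 - x)), ← add_div, div_self h]

/-- A smooth splitting of unity: `1` near `τ`, `0` near `-τ`, summing to one with its
reflection. -/
def splitting (τ θ : ℝ) : ℝ := Real.smoothTransition (1 / 2 + sin θ / sin τ)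

theorem splitting_add_neg (τ θ : ℝ) : splitting τ θ + splitting τ (-θ) = 1 := by
  rw [splitting, splitting, sin_neg,
    show 1 / 2 + -sin θ / sin τ = 1 - (1 / 2 + sin θ / sin τ) by ring]
  exact smoothTransition_add_one_sub _

theorem contDiff_splitting (m : ℕ) (τ : ℝ) : ContDiff ℝ m (splitting τ) := by
  have h1 : ContDiff ℝ m Real.smoothTransition := by
    exact_mod_cast Real.smoothTransition.contDiff (n := (m : ℕ∞))
  exact h1.comp (contDiff_const.add (contDiff_sin.div_const _))

/-- The second factor is singular only where sin((θ+τ)/2) = 0. There sin θ = -sin τ, the argument of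
the smooth transition is -1/2, and the product vanishes nearby. -/
theorem contDiff_splitting_mul_sinPow (m : ℕ) (α : ℝ) {τ : ℝ} (hτ : τ ∈ Set.Ioo 0 π) :
    ContDiff ℝ m fun θ => splitting τ θ * sinPow α (θ + τ) := by
  have hs := sin_pos_of_mem_Ioo hτ
  rw [contDiff_iff_contDiffAt]
  intro θ
  by_cases h0 : sin ((θ + τ) / 2) = 0
  · have hθ : sin θ = -sin τ := by
      have h1 : sin θ + sin τ = 0 := by
        have e1 : θ = (θ + τ) / 2 + (θ - τ) / 2 := by ring
        have e2 : τ = (θ + τ) / 2 - (θ - τ) / 2 := by ring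
        have h1 : sin θ = sin ((θ + τ) / 2 + (θ - τ) / 2) := by rw [← e1]
        have h2 : sin τ = sin ((θ + τ) / 2 - (θ - τ) / 2) := by rw [← e2]
        rw [h1, h2, sin_add, sin_sub, h0]; ring
      linarith
    have hev : ∀ᶠ u in 𝓝 θ, splitting τ u * sinPow α (u + τ) = 0 := by
      have : ∀ᶠ u in 𝓝 θ, 1 / 2 + sin u / sin τ < 0 := by
        have hc : Continuous fun u => 1 / 2 + sin u / sin τ := by fun_prop
        refine hc.continuousAt.eventually_lt continuousAt_const ?_
        rw [hθ, neg_div, div_self hs.ne']; norm_num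
      filter_upwards [this] with u hu
      rw [splitting, Real.smoothTransition.zero_of_nonpos hu.le, zero_mul]
    exact contDiffAt_const.congr_of_eventuallyEq hev
  · refine (contDiff_splitting m τ).contDiffAt.mul ?_
    have h1 : ContDiffAt ℝ m (fun u : ℝ => 2 * sin ((u + τ) / 2)) θ := by
      refine ContDiff.contDiffAt ?_
      exact contDiff_const.mul (contDiff_sin.comp ((contDiff_id.add contDiff_const).div_const 2))
    have h2 : 2 * sin ((θ + τ) / 2) ≠ 0 := mul_ne_zero two_ne_zero h0
    have h3 : ContDiffAt ℝ m (fun u : ℝ => |2 * sin ((u + τ) / 2)|) θ := h1.abs h2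
    exact h3.rpow_const_of_ne (abs_ne_zero.2 h2)

/-- Here β = α, and ψ absorbs the splitting, g and the mirror factor. The value of that factor at τ
is (2 sin τ)^α, the source of (1-ξ²)^(α/2). -/
theorem coeffExpansion_interior {α τ : ℝ} (hα : 0 < α) (hb : ∀ j : ℤ, α ≠ 2 * (j : ℝ))
    (hτ : τ ∈ Set.Ioo 0 π) {g : ℝ → ℝ}
    (hg : ContDiffOn ℝ (⌈α + 1⌉₊ + 5 : ℕ) g (Set.Icc (-1) 1)) :
    ∃ σ, CoeffExpansion (modelFun α (cos τ) g) (α + 1) τ (constI α (cos τ) g) σ := by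
  have hs := sin_pos_of_mem_Ioo hτ
  obtain ⟨σ, h⟩ := coeffExpansion_of_eq_add (f := modelFun α (cos τ) g)
    (ψ := fun θ => (2 : ℝ) ^ (-α) * (splitting τ θ * sinPow α (θ + τ) * g (cos θ))) hα hb τ
    (contDiff_const.mul ((contDiff_splitting_mul_sinPow _ α hτ).mul (contDiff_comp_cos hg)))
    (fun θ => by
      simp only [splitting, cos_add_two_pi, sin_add_two_pi]
      rw [show θ + 2 * π + τ = θ + τ + 2 * π by ring, sinPow_periodic])
    (fun θ => by
      have e1 : sinPow α (-θ - τ) = sinPow α (θ + τ) := by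
        rw [← sinPow_neg]; congr 1; ring
      have e2 : sinPow α (-θ + τ) = sinPow α (θ - τ) := by
        rw [← sinPow_neg]; congr 1; ring
      simp only [modelFun, abs_cos_sub_cos_rpow, e1, e2, cos_neg]
      linear_combination (-(2 : ℝ) ^ (-α) * sinPow α (θ - τ) * sinPow α (θ + τ) * g (cos θ))
        * splitting_add_neg τ θ)
  refine ⟨σ, ?_⟩
  convert h using 1
  have e1 : splitting τ τ = 1 := by
    rw [splitting, div_self hs.ne']
    exact Real.smoothTransition.one_of_one_le (by norm_num)
  have e2 : sinPow α (τ + τ) = 2 ^ α * sin τ ^ α := by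
    rw [sinPow, show (τ + τ) / 2 = τ by ring, abs_of_pos (by positivity),
      mul_rpow zero_le_two hs.le]
  have e3 : (1 - cos τ ^ 2) ^ (α / 2) = sin τ ^ α := by
    rw [← sin_sq, ← rpow_natCast, ← rpow_mul hs.le]; congr 1; push_cast; ring
  have e4 : (2 : ℝ) ^ (-α) * 2 ^ α = 1 := by rw [← rpow_add two_pos]; simp
  rw [e1, e2, constI, e3, sinPowConst, show π * (α / 2) = α * π / 2 by ring]
  linear_combination (4 * (Gamma (α + 1) * sin (α * π / 2) / π) * sin τ ^ α * g (cos τ)) * e4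

/-- For τ = 0 or π the two factors agree and merge into exponent 2α. The function is already even,
so P is half of it, whence 2^(-α-1). The number 2α is not an even integer because α is not an
integer. -/
theorem coeffExpansion_endpoint {α τ : ℝ} (hα : 0 < α) (hb : ∀ j : ℤ, α ≠ (j : ℝ))
    (hτ : τ = 0 ∨ τ = π) {g : ℝ → ℝ}
    (hg : ContDiffOn ℝ (⌈2 * α + 1⌉₊ + 5 : ℕ) g (Set.Icc (-1) 1)) :
    ∃ σ, CoeffExpansion (modelFun α (cos τ) g) (2 * α + 1) τ (constB α (cos τ) g) σ := by
  have hrefl : ∀ θ, sinPow α (θ + τ) = sinPow α (θ - τ) := fun θ => by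
    rcases hτ with rfl | rfl
    · simp
    · rw [← sinPow_periodic α (θ - π)]; congr 1; ring
  have hsq : ∀ u, sinPow (2 * α) u = sinPow α u * sinPow α u := fun u => by
    rw [sinPow, sinPow, two_mul α, rpow_add_of_nonneg (abs_nonneg _) hα.le hα.le]
  have e4 : (2 : ℝ) ^ (-α) = 2 * 2 ^ (-α - 1) := by
    rw [mul_comm, ← rpow_add_one two_ne_zero]; congr 1; ring
  obtain ⟨σ, h⟩ := coeffExpansion_of_eq_add (f := modelFun α (cos τ) g)
    (ψ := fun θ => (2 : ℝ) ^ (-α - 1) * g (cos θ)) (β := 2 * α) (by linarith)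
    (fun j hj => hb j (by linarith)) τ
    (contDiff_const.mul (contDiff_comp_cos hg))
    (fun θ => by simp only [cos_add_two_pi])
    (fun θ => by
      have e1 : sinPow α (-θ - τ) = sinPow α (θ - τ) := by
        rw [← hrefl θ, ← sinPow_neg]; congr 1; ring
      simp only [modelFun, abs_cos_sub_cos_rpow, hsq, e1, hrefl, cos_neg, e4]
      ring)
  refine ⟨σ, ?_⟩
  convert h using 1
  have e5 : (2 : ℝ) ^ (α - 1) * (4 * 2 ^ (-α - 1)) = 1 := by
    rw [mul_left_comm, ← rpow_add two_pos, show α - 1 + (-α - 1) = ((-2 : ℤ) : ℝ) by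
      push_cast; ring, rpow_intCast]
    norm_num
  have e6 : (0 : ℝ) < 2 ^ (α - 1) := by positivity
  have hpi := pi_pos.ne'
  rw [constB, sinPowConst, show π * (2 * α / 2) = α * π by ring]
  field_simp
  linear_combination (sin (α * π) * g (cos τ)) * e5

/-! ### Pointwise expansions, by resonance type -/

theorem sin_half_add_ne_zero {θ τ : ℝ} (hθ : θ ∈ Set.Icc 0 π) (hτ : τ ∈ Set.Icc 0 π)
    (hne : θ ≠ τ) : sin ((θ + τ) / 2) ≠ 0 := by
  refine (sin_pos_of_pos_of_lt_pi ?_ ?_).ne'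
  · rcases hne.lt_or_gt with h | h <;> linarith [hθ.1, hτ.1]
  · rcases hne.lt_or_gt with h | h <;> linarith [hθ.2, hτ.2]

theorem sin_half_sub_ne_zero {θ τ : ℝ} (hθ : θ ∈ Set.Icc 0 π) (hτ : τ ∈ Set.Icc 0 π)
    (hne : θ ≠ τ) : sin ((θ - τ) / 2) ≠ 0 := by
  intro h
  have := (sin_eq_zero_iff_of_lt_of_lt (by linarith [hθ.1, hτ.2, pi_pos])
    (by linarith [hθ.2, hτ.1, pi_pos])).1 h
  exact hne (by linarith)

theorem arccos_mem_Icc (x : ℝ) : arccos x ∈ Set.Icc 0 π := ⟨arccos_nonneg x, arccos_le_pi x⟩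

/-- Away from the singularity neither θ + τ nor θ - τ resonates. -/
theorem CoeffExpansion.isBigO_of_ne {f : ℝ → ℝ} {s A σ ξ x : ℝ}
    (h : CoeffExpansion f s (arccos ξ) A σ) (hf : ContinuousOn f (Set.Icc (-1) 1)) (hs : 1 < s)
    (hξ : ξ ∈ Set.Icc (-1 : ℝ) 1) (hx : x ∈ Set.Icc (-1 : ℝ) 1) (hne : x ≠ ξ) :
    (fun n : ℕ => f x - chebProj f n x - -(A / 4) *
      (chebU (2 * n) (cos (phiPlus ξ x)) + chebU (2 * n) (cos (phiMinus ξ x))) * (n : ℝ) ^ (-s))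
      =O[atTop] fun n : ℕ => (n : ℝ) ^ (-s - 1) := by
  have hne' : arccos x ≠ arccos ξ := fun h => hne (arccos_injOn hx hξ h)
  have hs0 : 0 < s := by linarith
  have key := h.isBigO hf hs
    (hasTail_cos hs0 (sin_half_add_ne_zero (arccos_mem_Icc x) (arccos_mem_Icc ξ) hne'))
    (hasTail_cos hs0 (sin_half_sub_ne_zero (arccos_mem_Icc x) (arccos_mem_Icc ξ) hne'))
  rw [cos_arccos hx.1 hx.2] at key
  refine key.congr_left fun n => ?_
  rw [phiPlus, phiMinus]
  ring

theorem hasTail_cos_zero {s ω : ℝ} (hs : 1 < s) (hω : ∀ n : ℕ, cos (n * ω) = 1) :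
    HasTail s (fun n => cos (n * ω) * (n : ℝ) ^ (-s))
      fun n => (n : ℝ) ^ (1 - s) / (s - 1) - (n : ℝ) ^ (-s) / 2 := by
  simp only [hω, one_mul]
  exact hasTail_rpow hs

/-- At θ = τ the difference frequency is 0 and resonates, while 2τ does not because 0 < τ < π. -/
theorem CoeffExpansion.isBigO_interior {f : ℝ → ℝ} {s A σ ξ : ℝ}
    (h : CoeffExpansion f s (arccos ξ) A σ) (hf : ContinuousOn f (Set.Icc (-1) 1)) (hs : 1 < s)
    (hξ : ξ ∈ Set.Ioo (-1 : ℝ) 1) :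
    (fun n : ℕ => f ξ - chebProj f n ξ - (A / (2 * (s - 1)) * (n : ℝ) ^ (1 - s)
      - A * ((chebU (2 * n) ξ + 1) / 4) * (n : ℝ) ^ (-s)))
      =O[atTop] fun n : ℕ => (n : ℝ) ^ (-s - 1) := by
  have hsin : sin ((arccos ξ + arccos ξ) / 2) ≠ 0 := by
    rw [show (arccos ξ + arccos ξ) / 2 = arccos ξ by ring]
    exact (sin_pos_of_pos_of_lt_pi (arccos_pos.2 hξ.2) (arccos_lt_pi.2 hξ.1)).ne'
  have key := h.isBigO hf hs (hasTail_cos (by linarith) hsin)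
    (hasTail_cos_zero hs fun n => by rw [sub_self, mul_zero, cos_zero])
  rw [cos_arccos hξ.1.le hξ.2.le] at key
  refine key.congr_left fun n => ?_
  rw [show (arccos ξ + arccos ξ) / 2 = arccos ξ by ring, cos_arccos hξ.1.le hξ.2.le]
  have : s - 1 ≠ 0 := by linarith
  field_simp
  ring

/-- Both frequencies, 0 and 2τ, lie in 2πℤ, so the resonant tail is counted twice. -/
theorem CoeffExpansion.isBigO_endpoint {f : ℝ → ℝ} {s A σ ξ : ℝ}
    (h : CoeffExpansion f s (arccos ξ) A σ) (hf : ContinuousOn f (Set.Icc (-1) 1)) (hs : 1 < s)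
    (hξ : ξ = 1 ∨ ξ = -1) :
    (fun n : ℕ => f ξ - chebProj f n ξ -
      A * (1 / (s - 1) * (n : ℝ) ^ (1 - s) - 1 / 2 * (n : ℝ) ^ (-s)))
      =O[atTop] fun n : ℕ => (n : ℝ) ^ (-s - 1) := by
  have hcos : ∀ n : ℕ, cos (n * (arccos ξ + arccos ξ)) = 1 := fun n => by
    rcases hξ with rfl | rfl
    · simp
    · rw [arccos_neg_one, ← two_mul, cos_nat_mul_two_pi]
  have key := h.isBigO hf hs (hasTail_cos_zero hs hcos)
    (hasTail_cos_zero hs fun n => by rw [sub_self, mul_zero, cos_zero])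
  have hξ' : cos (arccos ξ) = ξ := by
    rcases hξ with rfl | rfl <;> simp
  rw [hξ'] at key
  refine key.congr_left fun n => ?_
  ring

/-- At ξ = 1 the angles coincide; at ξ = -1 they differ by π, which changes the sign of both sines
in the quotient for U_{2n}. -/
theorem chebU_cos_phiPlus_eq {ξ x : ℝ} (hξ : ξ = 1 ∨ ξ = -1) (hx : x ∈ Set.Icc (-1 : ℝ) 1)
    (hne : x ≠ ξ) (n : ℕ) :
    chebU (2 * n) (cos (phiPlus ξ x)) = chebU (2 * n) (cos (phiMinus ξ x)) := by
  rcases hξ with rfl | rfl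
  · simp [phiPlus, phiMinus]
  · have hne' : arccos x ≠ arccos (-1) := fun h =>
      hne (arccos_injOn hx ⟨le_rfl, by norm_num⟩ h)
    have h1 := sin_half_sub_ne_zero (arccos_mem_Icc x) (arccos_mem_Icc (-1)) hne'
    have e : phiPlus (-1) x = phiMinus (-1) x + π := by
      rw [phiPlus, phiMinus, arccos_neg_one]; ring
    have h2 : sin (phiMinus (-1) x) ≠ 0 := h1
    have h3 : sin (phiMinus (-1) x + π) ≠ 0 := by rw [sin_add_pi]; exact neg_ne_zero.2 h2
    rw [e, chebU_two_mul_cos h3, chebU_two_mul_cos h2, sin_add_pi]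
    have : (2 * (n : ℝ) + 1) * (phiMinus (-1) x + π)
        = (2 * n + 1) * phiMinus (-1) x + π + n * (2 * π) := by ring
    rw [this, sin_add_nat_mul_two_pi, sin_add_pi, neg_div_neg_eq]

end ChebProj

end

theorem mainTheorem1 (α : ℝ) (hα : 0 < α) :
    ∃ m : ℕ, ∀ (ξ : ℝ) (g : ℝ → ℝ), ContDiffOn ℝ (m : WithTop ℕ∞) g (Set.Icc (-1) 1) →
      -- interior singularity
      (ξ ∈ Set.Ioo (-1 : ℝ) 1 → (∀ j : ℤ, α ≠ 2 * (j : ℝ)) →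
        (∀ x ∈ Set.Icc (-1 : ℝ) 1, x ≠ ξ →
          (fun n : ℕ =>
            ChebProj.modelFun α ξ g x - ChebProj.chebProj (ChebProj.modelFun α ξ g) n x
              - (-(ChebProj.constI α ξ g / 4)
                  * (ChebProj.chebU (2 * n) (Real.cos (ChebProj.phiPlus ξ x))
                    + ChebProj.chebU (2 * n) (Real.cos (ChebProj.phiMinus ξ x)))
                  * (n : ℝ) ^ (-α - 1)))
            =O[atTop] (fun n : ℕ => (n : ℝ) ^ (-α - 2))) ∧
        (fun n : ℕ =>
          ChebProj.modelFun α ξ g ξ - ChebProj.chebProj (ChebProj.modelFun α ξ g) n ξ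
            - (ChebProj.constI α ξ g / (2 * α) * (n : ℝ) ^ (-α)
                - ChebProj.constI α ξ g * ((ChebProj.chebU (2 * n) ξ + 1) / 4)
                  * (n : ℝ) ^ (-α - 1)))
          =O[atTop] (fun n : ℕ => (n : ℝ) ^ (-α - 2))) ∧
      -- endpoint singularity
      ((ξ = 1 ∨ ξ = -1) → (∀ j : ℤ, α ≠ (j : ℝ)) →
        (fun n : ℕ =>
          ChebProj.modelFun α ξ g ξ - ChebProj.chebProj (ChebProj.modelFun α ξ g) n ξ
            - ChebProj.constB α ξ g
              * (1 / (2 * α) * (n : ℝ) ^ (-2 * α) - 1 / 2 * (n : ℝ) ^ (-2 * α - 1)))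
          =O[atTop] (fun n : ℕ => (n : ℝ) ^ (-2 * α - 2)) ∧
        (∀ x ∈ Set.Icc (-1 : ℝ) 1, x ≠ ξ →
          ∀ φ : ℝ, (φ = ChebProj.phiPlus ξ x ∨ φ = ChebProj.phiMinus ξ x) →
          (fun n : ℕ =>
            ChebProj.modelFun α ξ g x - ChebProj.chebProj (ChebProj.modelFun α ξ g) n x
              - ChebProj.constB α ξ g
                * (-(ChebProj.chebU (2 * n) (Real.cos φ) / 2) * (n : ℝ) ^ (-2 * α - 1)))
            =O[atTop] (fun n : ℕ => (n : ℝ) ^ (-2 * α - 2)))) := by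

  -- The endpoint case, with β = 2α, needs the most smoothness; the same m then serves the interior
  -- case.
  refine ⟨⌈2 * α + 1⌉₊ + 5, fun ξ g hg => ⟨fun hξ hb => ?_, fun hξ hb => ?_⟩⟩
  · have hξ' : ξ ∈ Set.Icc (-1 : ℝ) 1 := ⟨hξ.1.le, hξ.2.le⟩
    have hm : ((⌈α + 1⌉₊ + 5 : ℕ) : WithTop ℕ∞) ≤ ((⌈2 * α + 1⌉₊ + 5 : ℕ) : WithTop ℕ∞) := by
      exact_mod_cast Nat.add_le_add_right (Nat.ceil_le_ceil (by linarith)) 5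
    obtain ⟨σ, h⟩ := ChebProj.coeffExpansion_interior hα hb
      ⟨Real.arccos_pos.2 hξ.2, Real.arccos_lt_pi.2 hξ.1⟩ (hg.of_le hm)
    rw [Real.cos_arccos hξ'.1 hξ'.2] at h
    have hf := ChebProj.continuousOn_modelFun (ξ := ξ) hα hg.continuousOn
    refine ⟨fun x hx hne => ?_, ?_⟩
    · have key := h.isBigO_of_ne hf (by linarith) hξ' hx hne
      rw [show -(α + 1) - 1 = -α - 2 by ring, show -(α + 1) = -α - 1 by ring] at key
      exact key
    · have key := h.isBigO_interior hf (by linarith) hξ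
      rw [show -(α + 1) - 1 = -α - 2 by ring, show -(α + 1) = -α - 1 by ring,
        show 1 - (α + 1) = -α by ring, show α + 1 - 1 = α by ring] at key
      exact key
  · have hξ' : ξ ∈ Set.Icc (-1 : ℝ) 1 := by
      rcases hξ with rfl | rfl <;> constructor <;> norm_num
    have hτ : Real.arccos ξ = 0 ∨ Real.arccos ξ = Real.pi := by
      rcases hξ with rfl | rfl
      · exact Or.inl Real.arccos_one
      · exact Or.inr Real.arccos_neg_one
    obtain ⟨σ, h⟩ := ChebProj.coeffExpansion_endpoint hα hb hτ hg
    rw [Real.cos_arccos hξ'.1 hξ'.2] at h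
    have hf := ChebProj.continuousOn_modelFun (ξ := ξ) hα hg.continuousOn
    refine ⟨?_, fun x hx hne φ hφ => ?_⟩
    · have key := h.isBigO_endpoint hf (by linarith) hξ
      rw [show -(2 * α + 1) - 1 = -2 * α - 2 by ring, show -(2 * α + 1) = -2 * α - 1 by ring,
        show 1 - (2 * α + 1) = -2 * α by ring, show 2 * α + 1 - 1 = 2 * α by ring] at key
      exact key
    · have key := h.isBigO_of_ne hf (by linarith) hξ' hx hne
      rw [show -(2 * α + 1) - 1 = -2 * α - 2 by ring,
        show -(2 * α + 1) = -2 * α - 1 by ring] at key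
      refine key.congr_left fun n => ?_
      have hU := ChebProj.chebU_cos_phiPlus_eq hξ hx hne n
      rcases hφ with rfl | rfl
      · rw [← hU]; ring
      · rw [hU]; ring
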